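/- Setting. Let $G$ be a connected $d$-regular simple graph on $n$ nodes, and let $G^+$ be obtained from $G$ by adding $d^\circ$ self-loops to every node, where $d^\circ=\mathcal O(d)$; put $d^+=d+d^\circ$. The edges of $G$ are called original edges. A finite number of indivisible tokens is distributed over the nodes; in every synchronous step $t=1,2,\dots$ each node $u$, having load $x_t(u)$, sends all its tokens along its $d^+$ outgoing edges (original edges and self-loops) of $G^+$. The discrepancy is the maximum load minus the minimum load; $K$ is the initial discrepancy ($\log K$ is read as $0$ if $K=0$). Let $1=\lambda_1\ge\lambda_2\ge\dots\ge\lambda_n$ be the eigenvalues (with multiplicity) of the transition matrix $\mathbf P$ of the random walk on $G^+$ ($\mathbf P(u,u)=d^\circ/d^+$, $\mathbf P(u,v)=1/d^+$ for adjacent $u,v$, and $0$ otherwise), and let $\mu=1-\max_{2\le i\le n}|\lambda_i|$ (this equals $1-\lambda_2$ if $d^\circ\ge d$ and $n \ge 2$). Let $\delta\ge 1$ be a constant and $1\le s\le d^\circ$. A balancer is called a good $s$-balancer (with fairness constant $\delta$; the basic case is $\delta=1$) if in every step $t$ and for every node $u$, with $x=x_t(u)$: 1. (round-fair) every edge of $G^+$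 leaving $u$ receives at least $\lfloor x/d^+\rfloor$ and at most $\lceil x/d^+\rceil$ tokens; 2. (cumulatively $\delta$-fair) the total numbers of tokens sent in steps $1,\dots,t$ over any two original edges leaving $u$ differ by at most $\delta$; 3. ($s$-self-preferring) at least $\min\{s,\;x-d^+\lfloor x/d^+\rfloor\}$ self-loops of $u$ receive $\lceil x/d^+\rceil$ tokens. Theorem. For every good $s$-balancer and every initial distribution of tokens, the discrepancy is at most $(2\delta+1)d^++4d^\circ$ at all times after $$\mathcal O\!\left(\frac{\log K+\log n}{\mu}+\frac{d}{s}\cdot\frac{\log^2 n}{\mu}\right)$$ steps, where the constant in $\mathcal O(\cdot)$ depends only on $\delta$ and on the constant in $d^\circ=\mathcal O(d)$. -/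

import Mathlib

namespace LoadBalancing

variable {V : Type*} [DecidableEq V] (G : SimpleGraph V) [DecidableRel G.Adj]

/-- Transition matrix of the random walk on the balancing graph, which is obtained from a
`d`-regular graph `G` by adding `l` self-loops to every node; its degree is `d + l`. -/
noncomputable def transition (d l : ℕ) : Matrix V V ℝ := fun u v =>
  if u = v then (l : ℝ) / ((d + l : ℕ) : ℝ)
  else if G.Adj u v then 1 / ((d + l : ℕ) : ℝ) else 0

theorem transition_isHermitian (d l : ℕ) : (transition G d l).IsHermitian := by
  ext u v
  simp only [Matrix.conjTranspose_apply, transition, star_trivial, eq_comm (a := v) (b := u),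
    G.adj_comm v u]

variable [Fintype V]

/-- The eigenvalue gap `1 - max_{2 ≤ i ≤ n} |λ_i|` of the transition matrix, whose eigenvalues,
listed with multiplicity in decreasing order, are `λ_1 = 1 ≥ λ_2 ≥ ⋯ ≥ λ_n`
(in Lean, `λ_{i+1}` is `eigenvalues₀ i`). -/
noncomputable def gap (d l : ℕ) : ℝ :=
  1 - sSup {a : ℝ | ∃ i : Fin (Fintype.card V), 0 < i.val ∧
    a = |(transition_isHermitian G d l).eigenvalues₀ i|}

/-- Maximum load minus minimum load. -/
def discrepancy [Nonempty V] (x : V → ℕ) : ℕ :=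
  Finset.univ.sup' Finset.univ_nonempty x - Finset.univ.inf' Finset.univ_nonempty x

/-- An execution of a load-balancing algorithm on the balancing graph with `l` self-loops per
node, in discrete synchronous steps. `load t u` is the number of tokens at `u` after `t` steps,
i.e. at the beginning of the next step (so `load 0` is the initial distribution); in that step
`u` sends `send t u v` tokens to each neighbour `v` and `keep t u i` tokens over its `i`-th
self-loop. Values `send t u v` for non-adjacent `u`, `v` play no role. -/
structure Execution (l : ℕ) where
  load : ℕ → V → ℕ
  send : ℕ → V → V → ℕ
  keep : ℕ → V → Fin l → ℕ
  load_eq : ∀ t u, load t u = ∑ v ∈ G.neighborFinset u, send t u v + ∑ i, keep t u i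
  load_succ : ∀ t u, load (t + 1) u = ∑ v ∈ G.neighborFinset u, send t v u + ∑ i, keep t u i

namespace Execution

variable {G} {l : ℕ} (A : Execution G l)

/-- Cumulative number of tokens sent over the original edge `(u, v)` in all steps up to and
including the one that starts from `load t`. -/
def cumulative (t : ℕ) (u v : V) : ℕ := ∑ τ ∈ Finset.range (t + 1), A.send τ u v

/-- Cumulative `δ`-fairness: every edge of the balancing graph receives at least `⌊x / d⁺⌋`
tokens, and the cumulative flows over the original edges of a node differ by at most `δ`. -/
def CumulativelyFair (d : ℕ) (δ : ℝ) : Prop :=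
  ∀ (t : ℕ) (u : V),
    (∀ v ∈ G.neighborFinset u, A.load t u / (d + l) ≤ A.send t u v) ∧
    (∀ i, A.load t u / (d + l) ≤ A.keep t u i) ∧
    ∀ v ∈ G.neighborFinset u, ∀ w ∈ G.neighborFinset u,
      |(A.cumulative t u v : ℝ) - (A.cumulative t u w : ℝ)| ≤ δ

/-- No edge of the balancing graph receives more than `⌈x / d⁺⌉` tokens. -/
def RoundsUpAtMost (d : ℕ) : Prop :=
  ∀ (t : ℕ) (u : V),
    (∀ v ∈ G.neighborFinset u, A.send t u v ≤ A.load t u ⌈/⌉ (d + l)) ∧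
    ∀ i, A.keep t u i ≤ A.load t u ⌈/⌉ (d + l)

/-- `s`-self-preference: at least `min {s, e}` self-loops receive `⌈x / d⁺⌉` tokens, where
`e = x - d⁺ ⌊x / d⁺⌋` is the number of excess tokens. -/
def SelfPreferring (d s : ℕ) : Prop :=
  ∀ (t : ℕ) (u : V),
    min s (A.load t u % (d + l)) ≤
      (Finset.univ.filter fun i => A.keep t u i = A.load t u ⌈/⌉ (d + l)).card

/-- Good `s`-balancer with fairness constant `δ` (`δ = 1` being the basic case): cumulatively
`δ`-fair, round-fair and `s`-self-preferring. -/
structure IsGoodBalancer (d : ℕ) (δ : ℝ) (s : ℕ) : Prop where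
  fair : A.CumulativelyFair d δ
  selfPreferring : A.SelfPreferring d s
  roundsUpAtMost : A.RoundsUpAtMost d

end Execution

end LoadBalancing

/-! ### Draining potentials over multiples of the degree -/

namespace LoadBalancing

/-! Write `D = d + l`, `P` for the transition matrix, `n` for the number of nodes and `μ` for the
gap. Diffusion shows that every node often visits moderate loads; a potential argument turns
"visits" into "stays".

Diffusion. Pretend that each node sends over all its `D` edges the average of what it sends over its
original edges, and let `Z_T` be the cumulative outflow. Then `Z_{T+1} = P Z_T + x_0 + ε_T`
(`outflow_succ`). Cumulative and round fairness bound `ε_T` by `δ D` uniformly in `T`, so rounding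
errors do not pile up. As `P` contracts mean-zero vectors by `1 - μ`, after time `log (K n) / μ` the
centred `Z` changes by only `O(δ D log n / μ)` over a window of any length. Hence the load of a node
averaged over `W` steps is within `2 l + O(δ D log n / μ) / W` of the mean
(`abs_sum_window_sub_le`). With `b = 20 δ log n / μ`, every window of length at least `b / (k +
1/2)` contains a visit to within `2 l + (k + 1/2) D` of the mean, from either side
(`exists_load_le`).

Potential. By round fairness all edges of a node lie on the same side of any multiple of `D` tokens,
so the total excess over such a level never increases. Self-preference keeps the first `s` units of
excess in place, so a node that loses them lowers the total by as much (`excess_step`). Weighting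
the level `j D` by `2 ^ j` yields a potential that shrinks by the factor `1 - s / (2 D)` in each
window in which all nodes visit level `0` (`weightedExcess_window`). By integrality it vanishes
after about `(D / s) (log (n D) + m)` windows from loads below `m D`. Deficits drain in the same
way, measured from a multiple of `D` plus `s`.

Assembly. The threshold is halved from `2 ^ I D`, with `2 ^ I ≈ b`, down to `D`, and then dropped to
`0`. Phase `i` uses windows of length about `b / 2 ^ i`, and the total is `O((D / s) b (log (n D) +
I))`, where `I = O(log b) = O(log n)` because `1 / μ` is polynomial in `n`. Both final thresholds
lie within `2 l + 3 D / 2` of the mean, so the discrepancy is at most `3 D + 4 l`. -/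

theorem sum_neighborFinset_comm {V M : Type*} [Fintype V] [AddCommMonoid M]
    (G : SimpleGraph V) [DecidableRel G.Adj] (g : V → V → M) :
    ∑ u, ∑ v ∈ G.neighborFinset u, g u v = ∑ u, ∑ v ∈ G.neighborFinset u, g v u := by
  refine Finset.sum_comm' ?_
  intro u v
  simp [G.adj_comm]

/-- One step of a flow whose signed excesses over some level are `g` on the edges and `h` on the
self-loops: the total positive excess decreases by what the nodes lose of their first `s` units. -/
theorem excess_step {V : Type*} [Fintype V] (G : SimpleGraph V) [DecidableRel G.Adj]
    (g : V → V → ℤ) (h y y' : V → ℤ) (s : ℤ)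
    (hy : ∀ u, y u = ∑ v ∈ G.neighborFinset u, g u v + h u)
    (hy' : ∀ u, y' u = ∑ v ∈ G.neighborFinset u, g v u + h u)
    (hpos : ∀ u, 0 ≤ y u → (∀ v ∈ G.neighborFinset u, 0 ≤ g u v) ∧ min s (y u) ≤ h u ∧ 0 ≤ h u)
    (hneg : ∀ u, y u ≤ 0 → (∀ v ∈ G.neighborFinset u, g u v ≤ 0) ∧ h u ≤ 0) :
    ∑ u, max (y' u) 0 + ∑ u, max (min s (max (y u) 0) - min s (max (y' u) 0)) 0 ≤
      ∑ u, max (y u) 0 := by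
  -- All outgoing terms of a node share one sign, so taking positive parts commutes with summing
  -- them; reindexing by receiver then leaves a nodewise inequality.
  have key : ∑ u, max (y u) 0 = ∑ u, (∑ v ∈ G.neighborFinset u, max (g v u) 0 + max (h u) 0) := by
    rw [Finset.sum_add_distrib, ← sum_neighborFinset_comm G fun u v => max (g u v) 0,
      ← Finset.sum_add_distrib]
    refine Finset.sum_congr rfl fun u _ => ?_
    rcases le_total 0 (y u) with hu | hu
    · obtain ⟨h1, -, h2⟩ := hpos u hu
      rw [max_eq_left hu, max_eq_left h2, hy u]
      congr 1
      exact Finset.sum_congr rfl fun v hv => (max_eq_left (h1 v hv)).symm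
    · obtain ⟨h1, h2⟩ := hneg u hu
      rw [max_eq_right hu, max_eq_right h2, Finset.sum_eq_zero, add_zero]
      exact fun v hv => max_eq_right (h1 v hv)
  rw [key, ← Finset.sum_add_distrib]
  refine Finset.sum_le_sum fun u _ => ?_
  have h1 : ∑ v ∈ G.neighborFinset u, g v u ≤ ∑ v ∈ G.neighborFinset u, max (g v u) 0 :=
    Finset.sum_le_sum fun v _ => le_max_left _ _
  have h2 : 0 ≤ ∑ v ∈ G.neighborFinset u, max (g v u) 0 :=
    Finset.sum_nonneg fun v _ => le_max_right _ _
  have h3 := hy' u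
  rcases le_total 0 (y u) with hu | hu
  · obtain ⟨-, h4, h5⟩ := hpos u hu
    omega
  · obtain ⟨-, h5⟩ := hneg u hu
    omega

/-- At every level `j * D`, the total excess of `y` decreases in each step by at least what the
nodes lose of their first `s` units of excess. -/
def Draining {V : Type*} [Fintype V] (D s : ℤ) (y : ℕ → V → ℤ) : Prop :=
  ∀ (j : ℕ) (t : ℕ),
    ∑ u, max (y (t + 1) u - j * D) 0 +
      ∑ u, max (min s (max (y t u - j * D) 0) - min s (max (y (t + 1) u - j * D) 0)) 0 ≤
    ∑ u, max (y t u - j * D) 0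

namespace Draining

variable {V : Type*} [Fintype V] {D s : ℤ} {y : ℕ → V → ℤ}

theorem shift (hy : Draining D s y) (k : ℕ) : Draining D s fun t u => y t u - k * D := by
  intro j t
  have := hy (k + j) t
  push_cast at this
  simpa only [sub_sub, ← add_mul] using this

theorem antitone_excess (hy : Draining D s y) (j : ℕ) :
    Antitone fun t => ∑ u, max (y t u - j * D) 0 := by
  refine antitone_nat_of_succ_le fun t => ?_
  have h := hy j t
  have : 0 ≤ ∑ u, max (min s (max (y t u - j * D) 0) - min s (max (y (t + 1) u - j * D) 0)) 0 :=
    Finset.sum_nonneg fun u _ => le_max_right _ _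
  linarith

theorem le_of_le (hy : Draining D s y) (j : ℕ) {t₀ t : ℕ} (ht : t₀ ≤ t)
    (h : ∀ u, y t₀ u ≤ j * D) (u : V) : y t u ≤ j * D := by
  have h1 := hy.antitone_excess j ht
  have h2 : ∑ u, max (y t₀ u - j * D) 0 = 0 :=
    Finset.sum_eq_zero fun u _ => max_eq_right (by linarith [h u])
  have h3 : max (y t u - j * D) 0 ≤ ∑ u, max (y t u - j * D) 0 :=
    Finset.single_le_sum (f := fun u => max (y t u - j * D) 0) (fun u _ => le_max_right _ _)
      (Finset.mem_univ u)
  have h4 : y t u - j * D ≤ max (y t u - j * D) 0 := le_max_left _ _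
  simp only at h1
  linarith

theorem excess_add_window_le (hy : Draining D s y) (j : ℕ) (t W : ℕ) :
    ∑ u, max (y (t + W) u - j * D) 0 +
      ∑ u, ∑ i ∈ Finset.range W, max (min s (max (y (t + i) u - j * D) 0) -
        min s (max (y (t + (i + 1)) u - j * D) 0)) 0 ≤
    ∑ u, max (y t u - j * D) 0 := by
  induction W with
  | zero => simp
  | succ W ih =>
    have h := hy j (t + W)
    simp only [Finset.sum_range_succ, Finset.sum_add_distrib]
    simp only [← add_assoc] at h ih ⊢
    linarith

/-- Up to its visit to `(-∞, 0]` a node loses all of its first `s` units over every level `j * D ≥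
0`, and telescoping charges this loss to the total excess. -/
theorem window_excess_le (hs : 0 ≤ s) (hD : 0 ≤ D) (hy : Draining D s y) (j : ℕ) (t W : ℕ)
    (hW : ∀ u, ∃ i ≤ W, y (t + i) u ≤ 0) :
    ∑ u, max (y (t + W) u - j * D) 0 + ∑ u, min s (max (y t u - j * D) 0) ≤
    ∑ u, max (y t u - j * D) 0 := by
  refine le_trans ?_ (hy.excess_add_window_le j t W)
  gcongr with u
  obtain ⟨i, hi, hyi⟩ := hW u
  have h0 : (0 : ℤ) ≤ j * D := by positivity
  have h1 : min s (max (y (t + i) u - j * D) 0) = 0 := by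
    rw [max_eq_right (by linarith)]; exact min_eq_right hs
  have h2 := Finset.sum_range_sub' (fun i => min s (max (y (t + i) u - j * D) 0)) i
  simp only [h1, add_zero, sub_zero] at h2
  rw [← h2]
  refine (Finset.sum_le_sum fun i _ => le_max_left _ 0).trans ?_
  exact Finset.sum_le_sum_of_subset_of_nonneg (by simpa using hi) fun _ _ _ => le_max_right _ _

end Draining

/-- The excess above level `0` weighted by powers of two over the levels `0, D, …`. -/
def weightedExcess {V : Type*} [Fintype V] (D : ℤ) (m : ℕ) (y : V → ℤ) : ℤ :=
  ∑ j ∈ Finset.range m, 2 ^ j * ∑ u, max (y u - j * D) 0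

/-- Summation by parts: the excess over level `j` is its part below level `j + 1` plus the excess
over level `j + 1`, and the weights up to `j` add up to less than `2 * 2 ^ j`. The geometric weights
make the constant independent of `m`; a single level would lose a factor `m`. -/
theorem sum_two_pow_excess_le {D s : ℤ} (hs : 0 ≤ s) (hsD : s ≤ D) (m : ℕ) (a : ℤ)
    (ha : a ≤ m * D) :
    s * ∑ j ∈ Finset.range m, 2 ^ j * max (a - j * D) 0 ≤
      2 * D * ∑ j ∈ Finset.range m, 2 ^ j * min s (max (a - j * D) 0) := by
  have hD : 0 ≤ D := hs.trans hsD
  have step : ∀ m : ℕ, ∑ j ∈ Finset.range m, 2 ^ j * max (a - j * D) 0 ≤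
      ∑ j ∈ Finset.range m, 2 * 2 ^ j * min D (max (a - j * D) 0) +
        2 ^ m * max (a - m * D) 0 := by
    intro m
    induction m with
    | zero => simp
    | succ m ih =>
      rw [Finset.sum_range_succ, Finset.sum_range_succ]
      have h1 : max (a - m * D) 0 =
          min D (max (a - m * D) 0) + max (a - (m + 1 : ℕ) * D) 0 := by
        push_cast
        rw [add_mul, one_mul]
        omega
      have h2 : (2 : ℤ) ^ m * max (a - m * D) 0 =
          2 ^ m * (min D (max (a - m * D) 0) + max (a - (m + 1 : ℕ) * D) 0) := by rw [← h1]
      rw [pow_succ]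
      linarith
  have h := step m
  rw [max_eq_right (by linarith : a - m * D ≤ 0), mul_zero, add_zero] at h
  refine (mul_le_mul_of_nonneg_left h hs).trans ?_
  rw [Finset.mul_sum, Finset.mul_sum]
  refine Finset.sum_le_sum fun j _ => ?_
  have h3 : s * min D (max (a - j * D) 0) ≤ D * min s (max (a - j * D) 0) := by
    rcases min_choice s (max (a - j * D) 0) with h | h <;> rw [h]
    · rw [mul_comm D]
      exact mul_le_mul_of_nonneg_left (min_le_left _ _) hs
    · refine (mul_le_mul_of_nonneg_left (min_le_right _ _) hs).trans ?_
      exact mul_le_mul_of_nonneg_right hsD (le_max_right _ _)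
  have h4 : (0 : ℤ) ≤ 2 * 2 ^ j := by positivity
  nlinarith [mul_le_mul_of_nonneg_left h3 h4]

namespace Draining

variable {V : Type*} [Fintype V] {D s : ℤ} {y : ℕ → V → ℤ}

theorem weightedExcess_window (hs : 0 ≤ s) (hsD : s ≤ D) (hy : Draining D s y) (m t W : ℕ)
    (hm : ∀ u, y t u ≤ m * D) (hW : ∀ u, ∃ i ≤ W, y (t + i) u ≤ 0) :
    2 * D * weightedExcess D m (y (t + W)) ≤ (2 * D - s) * weightedExcess D m (y t) := by
  have hD : 0 ≤ D := hs.trans hsD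
  have h1 : weightedExcess D m (y (t + W)) +
      ∑ j ∈ Finset.range m, 2 ^ j * ∑ u, min s (max (y t u - j * D) 0) ≤
      weightedExcess D m (y t) := by
    unfold weightedExcess
    rw [← Finset.sum_add_distrib]
    refine Finset.sum_le_sum fun j _ => ?_
    rw [← mul_add]
    exact mul_le_mul_of_nonneg_left (hy.window_excess_le hs hD j t W hW) (by positivity)
  have h2 : s * weightedExcess D m (y t) ≤
      2 * D * ∑ j ∈ Finset.range m, 2 ^ j * ∑ u, min s (max (y t u - j * D) 0) := by
    unfold weightedExcess
    simp only [Finset.mul_sum (s := Finset.univ)]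
    rw [Finset.sum_comm, Finset.sum_comm (t := Finset.univ), Finset.mul_sum, Finset.mul_sum]
    exact Finset.sum_le_sum fun u _ => sum_two_pow_excess_le hs hsD m _ (hm u)
  nlinarith [mul_le_mul_of_nonneg_left h1 (by positivity : 0 ≤ 2 * D)]

theorem weightedExcess_windows (hs : 0 ≤ s) (hsD : s ≤ D) (hD : 0 < D) (hy : Draining D s y)
    (m t W : ℕ) (hm : ∀ u, y t u ≤ m * D) (hW : ∀ t' ≥ t, ∀ u, ∃ i ≤ W, y (t' + i) u ≤ 0)
    (N : ℕ) :
    (weightedExcess D m (y (t + N * W)) : ℝ) ≤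
      (1 - (s : ℝ) / (2 * D)) ^ N * weightedExcess D m (y t) := by
  induction N with
  | zero => simp
  | succ N ih =>
    have h := hy.weightedExcess_window hs hsD m (t + N * W) W
      (fun u => hy.le_of_le m (Nat.le_add_right _ _) hm u) (hW _ (Nat.le_add_right _ _))
    have hD' : (0 : ℝ) < D := by exact_mod_cast hD
    have hsD' : (s : ℝ) ≤ D := by exact_mod_cast hsD
    have h' : 2 * (D : ℝ) * weightedExcess D m (y (t + N * W + W)) ≤
        (2 * D - s) * weightedExcess D m (y (t + N * W)) := by exact_mod_cast h
    have h0 : 0 ≤ 1 - (s : ℝ) / (2 * D) := by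
      rw [sub_nonneg, div_le_one (by positivity)]; linarith
    rw [show t + (N + 1) * W = t + N * W + W by ring, pow_succ', mul_assoc]
    refine le_trans ?_ (mul_le_mul_of_nonneg_left ih h0)
    rw [← mul_le_mul_iff_right₀ (by positivity : 0 < 2 * (D : ℝ))]
    refine h'.trans (le_of_eq ?_)
    field_simp

theorem weightedExcess_le (hD : 0 ≤ D) (m : ℕ) (y : V → ℤ) (hm : ∀ u, y u ≤ m * D) :
    weightedExcess D m y ≤ Fintype.card V * D * 4 ^ m := by
  have h1 : ∀ j ∈ Finset.range m, (2 : ℤ) ^ j * ∑ u, max (y u - j * D) 0 ≤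
      2 ^ j * (Fintype.card V * (m * D)) := by
    intro j _
    refine mul_le_mul_of_nonneg_left ?_ (by positivity)
    have : ∀ u ∈ Finset.univ, max (y u - j * D) 0 ≤ m * D := by
      intro u _
      have : (0 : ℤ) ≤ j * D := by positivity
      exact max_le (by linarith [hm u]) (by positivity)
    simpa using Finset.sum_le_card_nsmul _ _ _ this
  refine (Finset.sum_le_sum h1).trans ?_
  rw [← Finset.sum_mul]
  have h2 : ∑ j ∈ Finset.range m, (2 : ℤ) ^ j ≤ 2 ^ m := by
    have h := geom_sum_mul (2 : ℤ) m
    linarith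
  have h3 : (m : ℤ) ≤ 2 ^ m := by exact_mod_cast Nat.lt_two_pow_self.le
  have h4 : (4 : ℤ) ^ m = 2 ^ m * 2 ^ m := by rw [← mul_pow]; norm_num
  calc (∑ j ∈ Finset.range m, (2 : ℤ) ^ j) * (Fintype.card V * (m * D))
      ≤ 2 ^ m * (Fintype.card V * (2 ^ m * D)) := by gcongr
    _ = _ := by rw [h4]; ring

/-- If `y` visits `(-∞, 0]` at every node in every window of length `W`, then it is nonpositive
after logarithmically many windows. -/
theorem nonpos_of_windows (hs : 0 ≤ s) (hsD : s ≤ D) (hD : 0 < D) (hy : Draining D s y)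
    (m t W : ℕ) (hm : ∀ u, y t u ≤ m * D) (hmpos : 0 < m)
    (hW : ∀ t' ≥ t, ∀ u, ∃ i ≤ W, y (t' + i) u ≤ 0) (N : ℕ)
    (hN : (1 - (s : ℝ) / (2 * D)) ^ N * (Fintype.card V * D * 4 ^ m) < 1)
    {t' : ℕ} (ht' : t + N * W ≤ t') (u : V) : y t' u ≤ 0 := by
  have h1 := hy.weightedExcess_windows hs hsD hD m t W hm hW N
  have h2 : (weightedExcess D m (y t) : ℝ) ≤ Fintype.card V * D * 4 ^ m := by
    exact_mod_cast weightedExcess_le hD.le m (y t) hm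
  have hD' : (0 : ℝ) < D := by exact_mod_cast hD
  have hsD' : (s : ℝ) ≤ D := by exact_mod_cast hsD
  have h0 : 0 ≤ 1 - (s : ℝ) / (2 * D) := by
    rw [sub_nonneg, div_le_one (by positivity)]; linarith
  -- The potential is an integer, so being below `1` forces its level-`0` term, which has weight
  -- `1`, to vanish.
  have h3 : weightedExcess D m (y (t + N * W)) < 1 := by
    have := (h1.trans (mul_le_mul_of_nonneg_left h2 (pow_nonneg h0 N))).trans_lt hN
    exact_mod_cast this
  have h4 : ∑ u, max (y (t + N * W) u - (0 : ℕ) * D) 0 ≤ weightedExcess D m (y (t + N * W)) := by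
    have := Finset.single_le_sum
      (f := fun j : ℕ => (2 : ℤ) ^ j * ∑ u, max (y (t + N * W) u - j * D) 0)
      (fun j _ => mul_nonneg (by positivity) (Finset.sum_nonneg fun u _ => le_max_right _ _))
      (Finset.mem_range.2 hmpos)
    simpa [weightedExcess] using this
  have h5 : ∀ u, y (t + N * W) u ≤ (0 : ℕ) * D := by
    intro u
    have h6 : max (y (t + N * W) u - (0 : ℕ) * D) 0 ≤ _ :=
      Finset.single_le_sum (f := fun u => max (y (t + N * W) u - (0 : ℕ) * D) 0)
      (fun u _ => le_max_right _ _) (Finset.mem_univ u)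
    have h7 := le_max_left (y (t + N * W) u - (0 : ℕ) * D) 0
    linarith
  simpa using hy.le_of_le 0 ht' h5 u

end Draining

end LoadBalancing

/-! ### Spectrum of the transition matrix -/

open scoped Matrix
namespace LoadBalancing

section Spectral

variable {n : Type*} [Fintype n] [DecidableEq n] {A : Matrix n n ℝ}

theorem eigenvectorBasis_dotProduct_mulVec (hA : A.IsHermitian) (i : n) (f : n → ℝ) :
    (⇑(hA.eigenvectorBasis i) : n → ℝ) ⬝ᵥ (A *ᵥ f) =
      hA.eigenvalues i * ((⇑(hA.eigenvectorBasis i) : n → ℝ) ⬝ᵥ f) := by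
  have hT : Aᵀ = A := by simpa [Matrix.conjTranspose] using! hA
  rw [Matrix.dotProduct_mulVec, ← Matrix.mulVec_transpose, hT, hA.mulVec_eigenvectorBasis,
    smul_dotProduct, smul_eq_mul]

theorem eigenvectorBasis_dotProduct (hA : A.IsHermitian) (i j : n) :
    (⇑(hA.eigenvectorBasis i) : n → ℝ) ⬝ᵥ ⇑(hA.eigenvectorBasis j) = if i = j then 1 else 0 := by
  have h := orthonormal_iff_ite.1 hA.eigenvectorBasis.orthonormal i j
  rw [EuclideanSpace.inner_eq_star_dotProduct, dotProduct_comm] at h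
  simpa using h

theorem sum_sq_eigenvectorBasis_dotProduct (hA : A.IsHermitian) (f : n → ℝ) :
    ∑ i, ((⇑(hA.eigenvectorBasis i) : n → ℝ) ⬝ᵥ f) ^ 2 = f ⬝ᵥ f := by
  have h := hA.eigenvectorBasis.sum_sq_norm_inner_right (WithLp.toLp 2 f)
  rw [EuclideanSpace.norm_sq_eq] at h
  simp only [EuclideanSpace.inner_eq_star_dotProduct, Real.norm_eq_abs, sq_abs, star_trivial] at h
  simpa [dotProduct, sq, mul_comm] using h

end Spectral

section Transition

variable {V : Type*} [DecidableEq V] [Fintype V] {G : SimpleGraph V} [DecidableRel G.Adj]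

theorem transition_mulVec (d l : ℕ) (f : V → ℝ) (u : V) :
    (transition G d l *ᵥ f) u =
      (l * f u + ∑ v ∈ G.neighborFinset u, f v) / ((d + l : ℕ) : ℝ) := by
  have h : ∀ v, transition G d l u v * f v =
      (if u = v then l * f v / ((d + l : ℕ) : ℝ) else 0) +
        if G.Adj u v then f v / ((d + l : ℕ) : ℝ) else 0 := by
    intro v
    unfold transition
    by_cases huv : u = v
    · subst huv
      simp
      ring
    · simp only [huv, if_false, zero_add]
      split_ifs <;> ring
  simp only [Matrix.mulVec, dotProduct, h]
  rw [Finset.sum_add_distrib, add_div, Finset.sum_div, Finset.sum_ite_eq, ← Finset.sum_filter,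
    G.neighborFinset_eq_filter]
  simp

omit [DecidableEq V] in
theorem card_neighborFinset {d : ℕ} (hG : G.IsRegularOfDegree d) (u : V) :
    (G.neighborFinset u).card = d := by
  rw [G.card_neighborFinset_eq_degree, hG u]

omit [DecidableEq V] in
theorem sum_sum_neighborFinset_left {d : ℕ} (hG : G.IsRegularOfDegree d) (f : V → ℝ) :
    ∑ u, ∑ _v ∈ G.neighborFinset u, f u = d * ∑ u, f u := by
  simp only [Finset.sum_const, card_neighborFinset hG, nsmul_eq_mul, Finset.mul_sum]

omit [DecidableEq V] in
theorem sum_sum_neighborFinset_right {d : ℕ} (hG : G.IsRegularOfDegree d) (f : V → ℝ) :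
    ∑ u, ∑ v ∈ G.neighborFinset u, f v = d * ∑ u, f u := by
  rw [← sum_sum_neighborFinset_left hG, sum_neighborFinset_comm]

theorem transition_mulVec_one {d l : ℕ} (hG : G.IsRegularOfDegree d) (hD : 0 < d + l) :
    transition G d l *ᵥ 1 = 1 := by
  ext u
  have : ((d + l : ℕ) : ℝ) ≠ 0 := by exact_mod_cast hD.ne'
  rw [transition_mulVec, div_eq_iff this]
  simp only [Pi.one_apply, Finset.sum_const, card_neighborFinset hG, nsmul_eq_mul]
  push_cast
  ring

theorem dotProduct_transition_mulVec {d l : ℕ} (hD : 0 < d + l) (f : V → ℝ) :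
    ((d + l : ℕ) : ℝ) * (f ⬝ᵥ (transition G d l *ᵥ f)) =
      l * (f ⬝ᵥ f) + ∑ u, ∑ v ∈ G.neighborFinset u, f u * f v := by
  have : ((d + l : ℕ) : ℝ) ≠ 0 := by exact_mod_cast hD.ne'
  simp only [dotProduct, transition_mulVec, Finset.mul_sum, ← Finset.sum_add_distrib]
  refine Finset.sum_congr rfl fun u _ => ?_
  rw [← Finset.mul_sum]
  field_simp

omit [DecidableEq V] in
theorem sum_sum_sq_neighborFinset {d : ℕ} (hG : G.IsRegularOfDegree d) (f : V → ℝ) (c : ℝ) :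
    ∑ u, ∑ v ∈ G.neighborFinset u, (f u + c * f v) ^ 2 =
      (1 + c ^ 2) * d * (f ⬝ᵥ f) + 2 * c * ∑ u, ∑ v ∈ G.neighborFinset u, f u * f v := by
  have h1 := sum_sum_neighborFinset_left hG fun u => f u ^ 2
  have h2 := sum_sum_neighborFinset_right hG fun u => f u ^ 2
  have h3 : f ⬝ᵥ f = ∑ u, f u ^ 2 := by simp [dotProduct, sq]
  have h4 : ∀ u v, (f u + c * f v) ^ 2 = f u ^ 2 + c ^ 2 * f v ^ 2 + 2 * c * (f u * f v) := by
    intros; ring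
  simp only [h4, Finset.sum_add_distrib, ← Finset.mul_sum] at h1 h2 ⊢
  rw [h1, h2, h3]
  ring

/-- Cauchy–Schwarz along a path, which has fewer than `n` darts, all distinct. -/
theorem sq_sub_le_sum_sq_neighborFinset (hc : G.Connected) (f : V → ℝ) (a b : V) :
    (f a - f b) ^ 2 ≤
      Fintype.card V * ∑ u, ∑ v ∈ G.neighborFinset u, (f u - f v) ^ 2 := by
  obtain ⟨p, hp⟩ := hc.exists_isPath a b
  have h1 : ∀ {a b : V} (p : G.Walk a b),
      f a - f b = ((p.darts.map (·.toProd)).map fun e => f e.1 - f e.2).sum := by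
    intro a b p
    induction p with
    | nil => simp
    | cons h p ih =>
      simp only [SimpleGraph.Walk.darts_cons, List.map_cons, List.sum_cons, ← ih]
      ring
  have hnd : (p.darts.map (·.toProd)).Nodup := by
    refine List.Nodup.map SimpleGraph.Dart.toProd_injective ?_
    exact List.Nodup.of_map _ hp.isTrail.edges_nodup
  have h2 := h1 p
  rw [← List.sum_toFinset _ hnd] at h2
  set S := (p.darts.map (·.toProd)).toFinset with hS
  have hcard : (S.card : ℝ) ≤ Fintype.card V := by
    rw [hS, List.toFinset_card_of_nodup hnd]
    simpa using hp.length_lt.le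
  have hsub : ∑ e ∈ S, (f e.1 - f e.2) ^ 2 ≤
      ∑ u, ∑ v ∈ G.neighborFinset u, (f u - f v) ^ 2 := by
    have h3 : ∑ u, ∑ v ∈ G.neighborFinset u, (f u - f v) ^ 2 =
        ∑ e ∈ (Finset.univ.sigma fun u => G.neighborFinset u).map
          (Equiv.sigmaEquivProd V V).toEmbedding, (f e.1 - f e.2) ^ 2 := by
      rw [Finset.sum_sigma', Finset.sum_map]
      rfl
    rw [h3]
    refine Finset.sum_le_sum_of_subset_of_nonneg ?_ fun _ _ _ => sq_nonneg _
    rintro ⟨u, v⟩ he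
    simp only [hS, List.mem_toFinset, List.mem_map] at he
    obtain ⟨e, -, he⟩ := he
    have := e.adj
    rw [he] at this
    simpa using this
  rw [h2]
  refine sq_sum_le_card_mul_sum_sq.trans ?_
  exact mul_le_mul hcard hsub (Finset.sum_nonneg fun _ _ => sq_nonneg _) (by positivity)

/-- Poincaré inequality: as `f` has mean zero, each `u` has some `w` with `f u * f w ≤ 0`, so `f u ^
2 ≤ (f u - f w) ^ 2`. -/
theorem dotProduct_self_le_of_sum_eq_zero (hc : G.Connected) (f : V → ℝ) (hf : ∑ u, f u = 0) :
    f ⬝ᵥ f ≤ (Fintype.card V : ℝ) ^ 2 * ∑ u, ∑ v ∈ G.neighborFinset u, (f u - f v) ^ 2 := by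
  have h : ∀ u ∈ Finset.univ, f u * f u ≤
      Fintype.card V * ∑ u, ∑ v ∈ G.neighborFinset u, (f u - f v) ^ 2 := by
    intro u _
    obtain ⟨w, hw⟩ : ∃ w, f u * f w ≤ 0 := by
      by_contra! hcon
      have := Finset.sum_pos (fun w _ => hcon w) ⟨u, Finset.mem_univ u⟩
      rw [← Finset.mul_sum, hf, mul_zero] at this
      exact this.false
    refine le_trans ?_ (sq_sub_le_sum_sq_neighborFinset hc f u w)
    nlinarith [sq_nonneg (f w)]
  have := Finset.sum_le_card_nsmul _ _ _ h
  simp only [Finset.card_univ, nsmul_eq_mul] at this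
  simp only [dotProduct]
  linarith

variable {d l : ℕ}

theorem one_sub_eigenvalue_eq_sum_sq (hG : G.IsRegularOfDegree d) (hD : 0 < d + l) (i : V) :
    let e : V → ℝ := ⇑((transition_isHermitian G d l).eigenvectorBasis i)
    2 * ((d + l : ℕ) : ℝ) * (1 - (transition_isHermitian G d l).eigenvalues i) =
      ∑ u, ∑ v ∈ G.neighborFinset u, (e u - e v) ^ 2 := by
  intro e
  have h1 := sum_sum_sq_neighborFinset hG e (-1)
  have h2 := dotProduct_transition_mulVec (G := G) hD e
  have h3 := eigenvectorBasis_dotProduct_mulVec (transition_isHermitian G d l) i e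
  have h4 : e ⬝ᵥ e = 1 := by
    simpa using eigenvectorBasis_dotProduct (transition_isHermitian G d l) i i
  rw [h3, h4] at h2
  simp only [neg_one_mul, ← sub_eq_add_neg] at h1
  rw [h1, h4]
  push_cast at h2 ⊢
  linarith

theorem two_mul_le_one_add_eigenvalue (hG : G.IsRegularOfDegree d) (hD : 0 < d + l) (i : V) :
    2 * (l : ℝ) ≤ ((d + l : ℕ) : ℝ) * (1 + (transition_isHermitian G d l).eigenvalues i) := by
  set e : V → ℝ := ⇑((transition_isHermitian G d l).eigenvectorBasis i)
  have h1 := sum_sum_sq_neighborFinset hG e 1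
  have h2 := dotProduct_transition_mulVec (G := G) hD e
  have h3 := eigenvectorBasis_dotProduct_mulVec (transition_isHermitian G d l) i e
  have h4 : e ⬝ᵥ e = 1 := by
    simpa using eigenvectorBasis_dotProduct (transition_isHermitian G d l) i i
  rw [h3, h4] at h2
  have h5 : 0 ≤ ∑ u, ∑ v ∈ G.neighborFinset u, (e u + 1 * e v) ^ 2 :=
    Finset.sum_nonneg fun _ _ => Finset.sum_nonneg fun _ _ => sq_nonneg _
  rw [h1, h4] at h5
  push_cast at h2 ⊢
  linarith

/-- The index of the largest eigenvalue. -/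
noncomputable def topIndex (V : Type*) [Fintype V] [Nonempty V] : V :=
  Fintype.equivOfCardEq (Fintype.card_fin (Fintype.card V)) ⟨0, Fintype.card_pos⟩

/-- Some basis eigenvector is not orthogonal to the fixed vector `1`, so `1` is an eigenvalue and
the top one is at least `1`. The Dirichlet energy of the top eigenvector is then nonpositive, and
connectedness makes it constant. -/
theorem topEigenvector_const [Nonempty V] (hc : G.Connected) (hG : G.IsRegularOfDegree d)
    (hD : 0 < d + l) :
    let e : V → ℝ := ⇑((transition_isHermitian G d l).eigenvectorBasis (topIndex V))
    ∃ c : ℝ, c ≠ 0 ∧ ∀ u, e u = c := by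
  intro e
  set hA := transition_isHermitian G d l
  obtain ⟨i, hi⟩ : ∃ i, (⇑(hA.eigenvectorBasis i) : V → ℝ) ⬝ᵥ 1 ≠ 0 := by
    by_contra! hcon
    have h := sum_sq_eigenvectorBasis_dotProduct hA 1
    simp only [hcon] at h
    simp [dotProduct, eq_comm] at h
  have h1 : hA.eigenvalues i = 1 := by
    have h := eigenvectorBasis_dotProduct_mulVec hA i 1
    rw [transition_mulVec_one hG hD] at h
    exact mul_right_cancel₀ hi (by linarith)
  have h2 : 1 ≤ hA.eigenvalues (topIndex V) := by
    rw [← h1]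
    simp only [Matrix.IsHermitian.eigenvalues, topIndex, Equiv.symm_apply_apply]
    exact hA.eigenvalues₀_antitone (Fin.le_def.2 (Nat.zero_le _))
  have h3 := one_sub_eigenvalue_eq_sum_sq hG hD (topIndex V)
  have h4 : ∑ u, ∑ v ∈ G.neighborFinset u, (e u - e v) ^ 2 ≤ 0 := by
    have : 2 * ((d + l : ℕ) : ℝ) * (1 - hA.eigenvalues (topIndex V)) ≤ 0 :=
      mul_nonpos_of_nonneg_of_nonpos (by positivity) (by linarith)
    linarith
  have h5 : ∀ u, e u = e (topIndex V) := by
    intro u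
    have h := (sq_sub_le_sum_sq_neighborFinset hc e u (topIndex V)).trans
      (mul_nonpos_of_nonneg_of_nonpos (by positivity) h4)
    exact sub_eq_zero.1 (pow_eq_zero_iff two_ne_zero |>.1 (le_antisymm h (sq_nonneg _)))
  refine ⟨e (topIndex V), fun h0 => ?_, h5⟩
  have h6 : e ⬝ᵥ e = 1 := by
    simpa using eigenvectorBasis_dotProduct hA (topIndex V) (topIndex V)
  simp [dotProduct, h5, h0] at h6

theorem sum_eigenvector_eq_zero [Nonempty V] (hc : G.Connected) (hG : G.IsRegularOfDegree d)
    (hD : 0 < d + l)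
    {i : V} (hi : i ≠ topIndex V) :
    ∑ u, (transition_isHermitian G d l).eigenvectorBasis i u = 0 := by
  obtain ⟨c, hc0, h⟩ := topEigenvector_const hc hG hD
  have h1 := eigenvectorBasis_dotProduct (transition_isHermitian G d l) i (topIndex V)
  rw [if_neg hi] at h1
  simp only [dotProduct, h, ← Finset.sum_mul] at h1
  exact (mul_eq_zero.1 h1).resolve_right hc0

/-- The upper side is the Poincaré inequality, the lower side comes from the self-loops. The
resulting polynomial bound on the inverse gap is needed only inside a logarithm, so a crude one
suffices. -/
theorem abs_eigenvalue_le [Nonempty V] (hc : G.Connected) (hG : G.IsRegularOfDegree d) (hl : 1 ≤ l)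
    {i : V} (hi : i ≠ topIndex V) :
    |(transition_isHermitian G d l).eigenvalues i| ≤
      1 - 1 / (2 * ((d + l : ℕ) : ℝ) * (Fintype.card V : ℝ) ^ 2) := by
  have hD : 0 < d + l := by omega
  have hD' : (0 : ℝ) < ((d + l : ℕ) : ℝ) := by exact_mod_cast hD
  have hn : (1 : ℝ) ≤ Fintype.card V := by exact_mod_cast (Fintype.card_pos : 0 < Fintype.card V)
  set hA := transition_isHermitian G d l
  rw [abs_le]
  constructor
  · have h1 := two_mul_le_one_add_eigenvalue hG hD i
    have h2 : (1 : ℝ) / (2 * ((d + l : ℕ) : ℝ) * (Fintype.card V : ℝ) ^ 2) ≤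
        2 * l / ((d + l : ℕ) : ℝ) := by
      have hl' : (1 : ℝ) ≤ l := by exact_mod_cast hl
      rw [div_le_div_iff₀ (by positivity) hD']
      have : (1 : ℝ) ≤ (Fintype.card V : ℝ) ^ 2 := one_le_pow₀ hn
      have : 1 ≤ 2 * (l : ℝ) * (2 * (Fintype.card V : ℝ) ^ 2) := by nlinarith
      nlinarith
    have h3 : 2 * l / ((d + l : ℕ) : ℝ) ≤ 1 + hA.eigenvalues i := by
      rw [div_le_iff₀ hD']; linarith
    linarith
  · have h1 := one_sub_eigenvalue_eq_sum_sq hG hD i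
    have h2 := dotProduct_self_le_of_sum_eq_zero hc _ (sum_eigenvector_eq_zero hc hG hD hi)
    simp only [← h1] at h2
    have h4 := eigenvectorBasis_dotProduct hA i i
    rw [if_pos rfl] at h4
    rw [h4] at h2
    have : 1 / (2 * ((d + l : ℕ) : ℝ) * (Fintype.card V : ℝ) ^ 2) ≤ 1 - hA.eigenvalues i := by
      rw [div_le_iff₀ (by positivity)]
      linarith
    linarith

theorem exists_eigenvalues_eq [Nonempty V] {i : Fin (Fintype.card V)} (hi : 0 < i.val) :
    ∃ j ≠ topIndex V, (transition_isHermitian G d l).eigenvalues₀ i =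
      (transition_isHermitian G d l).eigenvalues j := by
  refine ⟨Fintype.equivOfCardEq (Fintype.card_fin (Fintype.card V)) i, ?_, ?_⟩
  · simp only [topIndex, ne_eq, EmbeddingLike.apply_eq_iff_eq]
    rintro rfl
    simp at hi
  · simp [Matrix.IsHermitian.eigenvalues]

variable (G d l) in
theorem gap_le_one : gap G d l ≤ 1 := by
  have : 0 ≤ sSup {a : ℝ | ∃ i : Fin (Fintype.card V), 0 < i.val ∧
      a = |(transition_isHermitian G d l).eigenvalues₀ i|} := by
    refine Real.sSup_nonneg ?_
    rintro _ ⟨i, -, rfl⟩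
    exact abs_nonneg _
  unfold gap
  linarith

theorem one_div_le_gap [Nonempty V] (hc : G.Connected) (hG : G.IsRegularOfDegree d) (hl : 1 ≤ l) :
    1 / (2 * ((d + l : ℕ) : ℝ) * (Fintype.card V : ℝ) ^ 2) ≤ gap G d l := by
  have hD' : (1 : ℝ) ≤ ((d + l : ℕ) : ℝ) := by exact_mod_cast (by omega : 1 ≤ d + l)
  have hn : (1 : ℝ) ≤ Fintype.card V := by exact_mod_cast (Fintype.card_pos : 0 < Fintype.card V)
  have : sSup {a : ℝ | ∃ i : Fin (Fintype.card V), 0 < i.val ∧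
      a = |(transition_isHermitian G d l).eigenvalues₀ i|} ≤
      1 - 1 / (2 * ((d + l : ℕ) : ℝ) * (Fintype.card V : ℝ) ^ 2) := by
    refine Real.sSup_le ?_ ?_
    · rintro _ ⟨i, hi, rfl⟩
      obtain ⟨j, hj, hij⟩ := exists_eigenvalues_eq (G := G) (d := d) (l := l) hi
      rw [hij]
      exact abs_eigenvalue_le hc hG hl hj
    · rw [sub_nonneg, div_le_one (by positivity)]
      have : (1 : ℝ) ≤ (Fintype.card V : ℝ) ^ 2 := one_le_pow₀ hn
      nlinarith
  unfold gap
  linarith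

theorem abs_eigenvalue_le_one_sub_gap [Nonempty V] {i : V} (hi : i ≠ topIndex V) :
    |(transition_isHermitian G d l).eigenvalues i| ≤ 1 - gap G d l := by
  unfold gap
  rw [sub_sub_cancel]
  refine le_csSup (Set.Finite.bddAbove (Set.Finite.subset (Set.finite_range
    fun i => |(transition_isHermitian G d l).eigenvalues₀ i|) ?_)) ?_
  · rintro _ ⟨i, -, rfl⟩
    exact ⟨i, rfl⟩
  · refine ⟨(Fintype.equivOfCardEq (Fintype.card_fin _)).symm i, ?_, rfl⟩
    rw [Nat.pos_iff_ne_zero]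
    intro h
    refine hi ?_
    rw [topIndex, ← Equiv.symm_apply_eq]
    exact Fin.ext h

theorem transition_mulVec_contraction [Nonempty V] (hc : G.Connected) (hG : G.IsRegularOfDegree d)
    (hD : 0 < d + l) (f : V → ℝ) (hf : ∑ u, f u = 0) :
    (transition G d l *ᵥ f) ⬝ᵥ (transition G d l *ᵥ f) ≤ (1 - gap G d l) ^ 2 * (f ⬝ᵥ f) := by
  set hA := transition_isHermitian G d l
  rw [← sum_sq_eigenvectorBasis_dotProduct hA, ← sum_sq_eigenvectorBasis_dotProduct hA f,
    Finset.mul_sum]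
  refine Finset.sum_le_sum fun i _ => ?_
  rw [eigenvectorBasis_dotProduct_mulVec, mul_pow]
  by_cases hi : i = topIndex V
  · subst hi
    obtain ⟨c, -, h⟩ := topEigenvector_const hc hG hD
    have : (⇑(hA.eigenvectorBasis (topIndex V)) : V → ℝ) ⬝ᵥ f = 0 := by
      simp only [dotProduct, h, ← Finset.mul_sum, hf, mul_zero]
    simp [this]
  · refine mul_le_mul_of_nonneg_right ?_ (sq_nonneg _)
    have h := abs_eigenvalue_le_one_sub_gap (G := G) (d := d) (l := l) hi
    exact sq_le_sq' (by linarith [(abs_le.1 h).1]) (abs_le.1 h).2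

end Transition

end LoadBalancing

/-! ### Mixing of a noisy linear recurrence -/

open scoped Matrix
namespace LoadBalancing

section Mixing

variable {V : Type*} [DecidableEq V] [Fintype V] {G : SimpleGraph V} [DecidableRel G.Adj]
  {d l : ℕ}

theorem abs_transition_mulVec_le (hG : G.IsRegularOfDegree d) (hD : 0 < d + l) {f : V → ℝ} {c : ℝ}
    (hf : ∀ u, |f u| ≤ c) (u : V) : |(transition G d l *ᵥ f) u| ≤ c := by
  have hD' : (0 : ℝ) < ((d + l : ℕ) : ℝ) := by exact_mod_cast hD
  rw [transition_mulVec, abs_div, abs_of_pos hD', div_le_iff₀ hD']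
  refine (abs_add_le _ _).trans ?_
  have h1 : |(l : ℝ) * f u| ≤ l * c := by
    rw [abs_mul, Nat.abs_cast]
    exact mul_le_mul_of_nonneg_left (hf u) (by positivity)
  have h2 : |∑ v ∈ G.neighborFinset u, f v| ≤ d * c := by
    refine (Finset.abs_sum_le_sum_abs _ _).trans ?_
    refine (Finset.sum_le_card_nsmul _ _ c fun v _ => hf v).trans ?_
    rw [card_neighborFinset hG, nsmul_eq_mul]
  push_cast
  linarith

theorem sum_transition_mulVec (hG : G.IsRegularOfDegree d) (hD : 0 < d + l) (f : V → ℝ) :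
    ∑ u, (transition G d l *ᵥ f) u = ∑ u, f u := by
  have hD' : (0 : ℝ) < ((d + l : ℕ) : ℝ) := by exact_mod_cast hD
  simp only [transition_mulVec]
  rw [← Finset.sum_div, Finset.sum_add_distrib, sum_sum_neighborFinset_right hG,
    ← Finset.mul_sum, div_eq_iff hD'.ne']
  push_cast
  ring

theorem abs_pow_mulVec_le (hG : G.IsRegularOfDegree d) (hD : 0 < d + l) {f : V → ℝ} {c : ℝ}
    (hf : ∀ u, |f u| ≤ c) (j : ℕ) (u : V) : |(transition G d l ^ j *ᵥ f) u| ≤ c := by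
  induction j generalizing u with
  | zero => simpa using hf u
  | succ j ih =>
    rw [pow_succ', ← Matrix.mulVec_mulVec]
    exact abs_transition_mulVec_le hG hD ih u

theorem sum_pow_mulVec (hG : G.IsRegularOfDegree d) (hD : 0 < d + l) (f : V → ℝ) (j : ℕ) :
    ∑ u, (transition G d l ^ j *ᵥ f) u = ∑ u, f u := by
  induction j with
  | zero => simp
  | succ j ih => rw [pow_succ', ← Matrix.mulVec_mulVec, sum_transition_mulVec hG hD, ih]

theorem pow_mulVec_contraction [Nonempty V] (hc : G.Connected) (hG : G.IsRegularOfDegree d)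
    (hD : 0 < d + l) (f : V → ℝ) (hf : ∑ u, f u = 0) (j : ℕ) :
    (transition G d l ^ j *ᵥ f) ⬝ᵥ (transition G d l ^ j *ᵥ f) ≤
      ((1 - gap G d l) ^ j) ^ 2 * (f ⬝ᵥ f) := by
  induction j with
  | zero => simp
  | succ j ih =>
    rw [pow_succ', ← Matrix.mulVec_mulVec]
    refine (transition_mulVec_contraction hc hG hD _ ?_).trans ?_
    · rw [sum_pow_mulVec hG hD, hf]
    · refine (mul_le_mul_of_nonneg_left ih (sq_nonneg _)).trans (le_of_eq ?_)
      ring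

/-- The Euclidean contraction is read in the sup norm; a factor `√n` would do, and `n` costs only a
constant in the mixing time. -/
theorem abs_pow_mulVec_le_pow [Nonempty V] (hc : G.Connected) (hG : G.IsRegularOfDegree d)
    (hD : 0 < d + l) {f : V → ℝ} (hf0 : ∑ u, f u = 0) {c : ℝ} (hf : ∀ u, |f u| ≤ c) (j : ℕ)
    (u : V) :
    |(transition G d l ^ j *ᵥ f) u| ≤ c * (Fintype.card V * (1 - gap G d l) ^ j) := by
  have hn : (1 : ℝ) ≤ Fintype.card V := by exact_mod_cast (Fintype.card_pos : 0 < Fintype.card V)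
  have hc0 : 0 ≤ c := (abs_nonneg _).trans (hf u)
  have hρ : 0 ≤ 1 - gap G d l := by linarith [gap_le_one G d l]
  refine abs_le_of_sq_le_sq ?_ (by positivity)
  have h1 := pow_mulVec_contraction hc hG hD f hf0 j
  have h2 : (transition G d l ^ j *ᵥ f) u ^ 2 ≤
      (transition G d l ^ j *ᵥ f) ⬝ᵥ (transition G d l ^ j *ᵥ f) := by
    rw [sq]
    exact Finset.single_le_sum
      (f := fun u => (transition G d l ^ j *ᵥ f) u * (transition G d l ^ j *ᵥ f) u)
      (fun v _ => mul_self_nonneg _) (Finset.mem_univ u)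
  have h3 : f ⬝ᵥ f ≤ Fintype.card V * c ^ 2 := by
    have : ∀ v ∈ Finset.univ, f v * f v ≤ c ^ 2 := fun v _ => by
      rw [← sq, ← sq_abs]; exact pow_le_pow_left₀ (abs_nonneg _) (hf v) 2
    simpa [dotProduct] using Finset.sum_le_card_nsmul _ _ _ this
  calc (transition G d l ^ j *ᵥ f) u ^ 2
      ≤ ((1 - gap G d l) ^ j) ^ 2 * (Fintype.card V * c ^ 2) :=
        h2.trans (h1.trans (mul_le_mul_of_nonneg_left h3 (sq_nonneg _)))
    _ ≤ ((1 - gap G d l) ^ j) ^ 2 * ((Fintype.card V) ^ 2 * c ^ 2) := by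
        gcongr
        nlinarith
    _ = _ := by ring

/-- The deviation of `f` from its mean. -/
noncomputable def center (f : V → ℝ) (u : V) : ℝ := f u - (∑ v, f v) / Fintype.card V

omit [DecidableEq V] in
theorem center_add (f g : V → ℝ) : center (f + g) = center f + center g := by
  ext u
  simp only [center, Pi.add_apply, Finset.sum_add_distrib]
  ring

omit [DecidableEq V] in
theorem sum_center [Nonempty V] (f : V → ℝ) : ∑ u, center f u = 0 := by
  simp only [center, Finset.sum_sub_distrib, Finset.sum_const, nsmul_eq_mul, Finset.card_univ]
  field_simp
  ring

theorem center_transition_mulVec (hG : G.IsRegularOfDegree d) (hD : 0 < d + l) (f : V → ℝ) :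
    center (transition G d l *ᵥ f) = transition G d l *ᵥ center f := by
  have h : center f = f - ((∑ v, f v) / Fintype.card V) • (1 : V → ℝ) := by
    ext u; simp [center]
  rw [h, Matrix.mulVec_sub, Matrix.mulVec_smul, transition_mulVec_one hG hD]
  ext u
  simp [center, sum_transition_mulVec hG hD]

omit [DecidableEq V] in
theorem abs_center_le [Nonempty V] {f : V → ℝ} {K : ℝ} (hf : ∀ u v, f u - f v ≤ K) (u : V) :
    |center f u| ≤ K := by
  have hn : (0 : ℝ) < Fintype.card V := by exact_mod_cast (Fintype.card_pos : 0 < Fintype.card V)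
  have h : center f u = (∑ v, (f u - f v)) / Fintype.card V := by
    simp only [center, Finset.sum_sub_distrib, Finset.sum_const, nsmul_eq_mul, Finset.card_univ]
    field_simp
  rw [h, abs_div, abs_of_pos hn, div_le_iff₀ hn]
  refine (Finset.abs_sum_le_sum_abs _ _).trans ?_
  have := Finset.sum_le_card_nsmul Finset.univ (fun v => |f u - f v|) K
    fun v _ => abs_le.2 ⟨by linarith [hf v u], hf u v⟩
  rw [nsmul_eq_mul, Finset.card_univ] at this
  linarith

/-- Duhamel's formula; centring commutes with the transition matrix because that matrix fixes
constants and preserves sums. -/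
theorem center_eq_of_recurrence (hG : G.IsRegularOfDegree d) (hD : 0 < d + l) {Z ε : ℕ → V → ℝ}
    {x : V → ℝ} (h0 : Z 0 = 0) (hZ : ∀ T, Z (T + 1) = transition G d l *ᵥ Z T + x + ε T) (T : ℕ) :
    center (Z T) = ∑ j ∈ Finset.range T, transition G d l ^ j *ᵥ center x +
      ∑ j ∈ Finset.range T, transition G d l ^ (T - 1 - j) *ᵥ center (ε j) := by
  induction T with
  | zero => ext u; simp [h0, center]
  | succ T ih =>
    rw [hZ, center_add, center_add, center_transition_mulVec hG hD, ih, Matrix.mulVec_add,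
      Matrix.mulVec_sum, Matrix.mulVec_sum, Finset.sum_range_succ', Finset.sum_range_succ (n := T)]
    simp only [Matrix.mulVec_mulVec, ← pow_succ', pow_zero, Matrix.one_mulVec,
      Nat.add_sub_cancel, Nat.sub_self]
    have : ∀ j ∈ Finset.range T, transition G d l ^ (T - 1 - j + 1) *ᵥ center (ε j) =
        transition G d l ^ (T - j) *ᵥ center (ε j) := by
      intro j hj
      rw [Finset.mem_range] at hj
      congr 2
      omega
    rw [Finset.sum_congr rfl this]
    abel

/-- The first `m` terms are at most `1`, the later ones are dominated by a geometric series. -/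
theorem sum_min_one_le {ρ n : ℝ} (hρ0 : 0 ≤ ρ) (hρ1 : ρ < 1) {m : ℕ} (hm : n * ρ ^ m ≤ 1)
    (T : ℕ) : ∑ j ∈ Finset.range T, min 1 (n * ρ ^ j) ≤ m + 1 / (1 - ρ) := by
  have hgeom : ∀ T, ∑ j ∈ Finset.range T, ρ ^ j ≤ 1 / (1 - ρ) := fun T => by
    rw [one_div, ← tsum_geometric_of_lt_one hρ0 hρ1]
    exact (summable_geometric_of_lt_one hρ0 hρ1).sum_le_tsum _ fun _ _ => pow_nonneg hρ0 _
  have h1 : ∀ T, ∑ j ∈ Finset.range T, min 1 (n * ρ ^ j) ≤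
      ∑ j ∈ Finset.range T, ((if j < m then (1 : ℝ) else 0) + if m ≤ j then ρ ^ (j - m) else 0) := by
    intro T
    refine Finset.sum_le_sum fun j _ => ?_
    by_cases hj : j < m
    · simp [hj, not_le.2 hj]
    · rw [if_neg hj, if_pos (not_lt.1 hj), zero_add]
      refine (min_le_right _ _).trans ?_
      obtain ⟨k, rfl⟩ := Nat.exists_eq_add_of_le (not_lt.1 hj)
      rw [pow_add, ← mul_assoc, Nat.add_sub_cancel_left]
      exact mul_le_of_le_one_left (pow_nonneg hρ0 k) hm
  refine (h1 T).trans ?_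
  rw [Finset.sum_add_distrib]
  refine add_le_add ?_ ?_
  · rw [← Finset.sum_filter, Finset.sum_const, nsmul_eq_mul, mul_one]
    have : (Finset.range T).filter (· < m) ⊆ Finset.range m := by
      intro j; simp
    simpa using Finset.card_le_card this
  · rw [← Finset.sum_filter]
    refine le_trans (le_of_eq ?_) (hgeom (T - m))
    refine Finset.sum_nbij' (fun j => j - m) (fun j => j + m) ?_ ?_ ?_ ?_ ?_ <;>
      simp only [Finset.mem_filter, Finset.mem_range] <;> intros <;> first | omega | trivial

/-- In Duhamel's formula the first `T` powers applied to `x` cancel. The others begin when `hT` has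
already brought the deviation below `1`, so they sum to at most `1 / gap`. The noise is bounded at
each of the two times separately, by `2 * c * (m + 1 / gap)`. -/
theorem abs_center_sub_center_le [Nonempty V] (hc : G.Connected) (hG : G.IsRegularOfDegree d)
    (hD : 0 < d + l) (hgap : 0 < gap G d l) {Z ε : ℕ → V → ℝ}
    {x : V → ℝ} (h0 : Z 0 = 0) (hZ : ∀ T, Z (T + 1) = transition G d l *ᵥ Z T + x + ε T)
    {K c : ℝ} (hx : ∀ u v, x u - x v ≤ K) (hε : ∀ T u, |ε T u| ≤ c) {m T : ℕ}
    (hm : Fintype.card V * (1 - gap G d l) ^ m ≤ 1)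
    (hT : K * (Fintype.card V * (1 - gap G d l) ^ T) ≤ 1) (W : ℕ) (u : V) :
    |center (Z (T + W)) u - center (Z T) u| ≤
      4 * c * (m + 1 / gap G d l) + 1 / gap G d l := by
  have hρ : 0 ≤ 1 - gap G d l := by linarith [gap_le_one G d l]
  have hc0 : 0 ≤ c := (abs_nonneg _).trans (hε 0 u)
  have hε' : ∀ j u, |center (ε j) u| ≤ 2 * c := fun j => abs_center_le fun u v => by
    linarith [(abs_le.1 (hε j u)).2, (abs_le.1 (hε j v)).1]
  have hnoise : ∀ T, |∑ j ∈ Finset.range T, (transition G d l ^ (T - 1 - j) *ᵥ center (ε j)) u| ≤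
      2 * c * (m + 1 / gap G d l) := by
    intro T
    refine (Finset.abs_sum_le_sum_abs _ _).trans ?_
    have h1 : ∀ j ∈ Finset.range T, |(transition G d l ^ (T - 1 - j) *ᵥ center (ε j)) u| ≤
        2 * c * min 1 (Fintype.card V * (1 - gap G d l) ^ (T - 1 - j)) := by
      intro j _
      rw [mul_min_of_nonneg _ _ (by positivity), mul_one]
      exact le_min (abs_pow_mulVec_le hG hD (hε' j) _ u)
        (abs_pow_mulVec_le_pow hc hG hD (sum_center _) (hε' j) _ u)
    refine (Finset.sum_le_sum h1).trans ?_
    rw [← Finset.mul_sum,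
      Finset.sum_range_reflect (fun j => min 1 (Fintype.card V * (1 - gap G d l) ^ j)) T]
    refine mul_le_mul_of_nonneg_left ?_ (by positivity)
    simpa using sum_min_one_le hρ (by linarith) hm T
  have hinit : |∑ j ∈ Finset.range W, (transition G d l ^ (T + j) *ᵥ center x) u| ≤
      1 / gap G d l := by
    refine (Finset.abs_sum_le_sum_abs _ _).trans ?_
    have h1 : ∀ j ∈ Finset.range W, |(transition G d l ^ (T + j) *ᵥ center x) u| ≤
        min 1 (1 * (1 - gap G d l) ^ j) := by
      intro j _
      have h2 := abs_pow_mulVec_le_pow hc hG hD (sum_center _) (abs_center_le hx) (T + j) u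
      have h3 : K * (Fintype.card V * (1 - gap G d l) ^ (T + j)) ≤ 1 * (1 - gap G d l) ^ j := by
        rw [pow_add, ← mul_assoc, ← mul_assoc, mul_assoc K]
        exact mul_le_mul_of_nonneg_right hT (pow_nonneg hρ j)
      have h4 : 1 * (1 - gap G d l) ^ j ≤ 1 := by
        rw [one_mul]; exact pow_le_one₀ hρ (by linarith)
      exact le_min ((h2.trans h3).trans h4) (h2.trans h3)
    refine (Finset.sum_le_sum h1).trans ?_
    simpa using sum_min_one_le (m := 0) (n := 1) hρ (by linarith) (by simp) W
  have hsplit : center (Z (T + W)) u - center (Z T) u =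
      ∑ j ∈ Finset.range W, (transition G d l ^ (T + j) *ᵥ center x) u +
      ∑ j ∈ Finset.range (T + W), (transition G d l ^ (T + W - 1 - j) *ᵥ center (ε j)) u -
      ∑ j ∈ Finset.range T, (transition G d l ^ (T - 1 - j) *ᵥ center (ε j)) u := by
    rw [center_eq_of_recurrence hG hD h0 hZ, center_eq_of_recurrence hG hD h0 hZ]
    simp only [Pi.add_apply, Finset.sum_apply, Finset.sum_range_add]
    ring
  rw [hsplit]
  have ha := abs_le.1 (hnoise T)
  have hb := abs_le.1 (hnoise (T + W))
  have hi := abs_le.1 hinit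
  rw [abs_le]
  constructor <;> linarith [ha.1, ha.2, hb.1, hb.2, hi.1, hi.2]

end Mixing

/-! ### Cumulative flows and time-averaged loads -/

theorem ceilDiv_le_div_add_one (a : ℕ) {b : ℕ} (hb : 0 < b) : a ⌈/⌉ b ≤ a / b + 1 := by
  rw [ceilDiv_le_iff_le_mul hb]
  nlinarith [Nat.div_add_mod a b, Nat.mod_lt a hb]

namespace Execution

variable {V : Type*} [DecidableEq V] [Fintype V] {G : SimpleGraph V} [DecidableRel G.Adj]
  {d l : ℕ} (A : Execution G l)

/-- Average number of tokens sent over an original edge leaving `u`. -/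
noncomputable def meanSend (d t : ℕ) (u : V) : ℝ :=
  (∑ v ∈ G.neighborFinset u, (A.send t u v : ℝ)) / d

/-- What remains of the load of `u` after giving every edge the average share of an original
edge. -/
noncomputable def remainder (d t : ℕ) (u : V) : ℝ :=
  A.load t u - ((d + l : ℕ) : ℝ) * A.meanSend d t u

/-- Cumulative outflow of `u` in the first `T` steps, if all its edges carried the average load
of its original edges. -/
noncomputable def outflow (d T : ℕ) (u : V) : ℝ :=
  ∑ t ∈ Finset.range T, ((d + l : ℕ) : ℝ) * A.meanSend d t u

/-- Cumulative rounding error of the inflow of `u` in the first `T` steps. -/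
noncomputable def inflowError (d T : ℕ) (u : V) : ℝ :=
  ∑ t ∈ Finset.range T, ∑ v ∈ G.neighborFinset u, ((A.send t v u : ℝ) - A.meanSend d t v)

variable {A} {δ : ℝ} {s : ℕ}

omit [DecidableEq V] in
theorem mul_meanSend (hd : 0 < d) (t : ℕ) (u : V) :
    d * A.meanSend d t u = ∑ v ∈ G.neighborFinset u, (A.send t u v : ℝ) := by
  unfold meanSend
  field_simp

omit [DecidableEq V] in
-- The remainder is the sum over the `l` self-loops of their flow minus the mean original flow, and
-- both lie in `[q, q + 1]`.
theorem abs_remainder_le (hG : G.IsRegularOfDegree d) (hd : 0 < d) (hA : A.IsGoodBalancer d δ s)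
    (t : ℕ) (u : V) : |A.remainder d t u| ≤ l := by
  have hd' : (0 : ℝ) < d := by exact_mod_cast hd
  set q := A.load t u / (d + l) with hq
  have hceil : A.load t u ⌈/⌉ (d + l) ≤ q + 1 := ceilDiv_le_div_add_one _ (by omega)
  obtain ⟨hs, hk, -⟩ := hA.fair t u
  obtain ⟨hs', hk'⟩ := hA.roundsUpAtMost t u
  have h1 : d * (q : ℝ) ≤ d * A.meanSend d t u := by
    rw [mul_meanSend hd, ← card_neighborFinset hG u, ← nsmul_eq_mul]
    exact Finset.card_nsmul_le_sum _ _ _ fun v hv => by exact_mod_cast hs v hv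
  have h2 : d * A.meanSend d t u ≤ d * ((q : ℝ) + 1) := by
    rw [mul_meanSend hd, ← card_neighborFinset hG u, ← nsmul_eq_mul]
    exact Finset.sum_le_card_nsmul _ _ _ fun v hv => by exact_mod_cast (hs' v hv).trans hceil
  have h3 : l * (q : ℝ) ≤ ∑ i, (A.keep t u i : ℝ) := by
    have := Finset.card_nsmul_le_sum Finset.univ (fun i => (A.keep t u i : ℝ)) q
      fun i _ => by exact_mod_cast hk i
    simpa using this
  have h4 : ∑ i, (A.keep t u i : ℝ) ≤ l * ((q : ℝ) + 1) := by
    have := Finset.sum_le_card_nsmul Finset.univ (fun i => (A.keep t u i : ℝ)) (q + 1)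
      fun i _ => by exact_mod_cast (hk' i).trans hceil
    simpa only [Finset.card_univ, Fintype.card_fin, nsmul_eq_mul] using this
  have h5 : A.remainder d t u = ∑ i, (A.keep t u i : ℝ) - l * A.meanSend d t u := by
    have := mul_meanSend (A := A) hd t u
    rw [remainder, A.load_eq]
    push_cast
    linarith
  have h6 := mul_le_mul_of_nonneg_left (le_of_mul_le_mul_left h1 hd') (Nat.cast_nonneg (α := ℝ) l)
  have h7 := mul_le_mul_of_nonneg_left (le_of_mul_le_mul_left h2 hd') (Nat.cast_nonneg (α := ℝ) l)
  rw [h5, abs_le]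
  constructor <;> linarith

omit [DecidableEq V] in
-- Exchanging sums turns the error into `d` differences between a cumulative edge flow and the
-- average over the sender's edges, each at most `δ`. This is why the bound does not grow with `T`.
theorem abs_inflowError_le (hG : G.IsRegularOfDegree d) (hd : 0 < d) (hδ : 0 ≤ δ)
    (hA : A.IsGoodBalancer d δ s) (T : ℕ) (u : V) : |A.inflowError d T u| ≤ δ * d := by
  have hd' : (0 : ℝ) < d := by exact_mod_cast hd
  cases T with
  | zero => simp [inflowError]; positivity
  | succ T =>
    have h1 : A.inflowError d (T + 1) u = ∑ v ∈ G.neighborFinset u,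
        ((A.cumulative T v u : ℝ) - (∑ w ∈ G.neighborFinset v, (A.cumulative T v w : ℝ)) / d) := by
      unfold inflowError cumulative meanSend
      rw [Finset.sum_comm]
      refine Finset.sum_congr rfl fun v _ => ?_
      push_cast
      rw [Finset.sum_sub_distrib, ← Finset.sum_div, Finset.sum_comm]
    have h2 : ∀ v ∈ G.neighborFinset u, |(A.cumulative T v u : ℝ) -
        (∑ w ∈ G.neighborFinset v, (A.cumulative T v w : ℝ)) / d| ≤ δ := by
      intro v hv
      have hu : u ∈ G.neighborFinset v := by
        rw [SimpleGraph.mem_neighborFinset] at hv ⊢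
        exact hv.symm
      have h3 : (A.cumulative T v u : ℝ) - (∑ w ∈ G.neighborFinset v, (A.cumulative T v w : ℝ)) / d
          = (∑ w ∈ G.neighborFinset v, ((A.cumulative T v u : ℝ) - A.cumulative T v w)) / d := by
        rw [Finset.sum_sub_distrib, Finset.sum_const, card_neighborFinset hG, nsmul_eq_mul]
        field_simp
      rw [h3, abs_div, abs_of_pos hd', div_le_iff₀ hd']
      refine (Finset.abs_sum_le_sum_abs _ _).trans ?_
      refine (Finset.sum_le_card_nsmul _ _ δ fun w hw => (hA.fair T v).2.2 u hu w hw).trans ?_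
      rw [card_neighborFinset hG, nsmul_eq_mul, mul_comm]
    rw [h1]
    refine (Finset.abs_sum_le_sum_abs _ _).trans ?_
    refine (Finset.sum_le_card_nsmul _ _ δ h2).trans ?_
    rw [card_neighborFinset hG, nsmul_eq_mul, mul_comm]

omit [DecidableEq V] in
theorem sum_load (t : ℕ) : ∑ u, A.load t u = ∑ u, A.load 0 u := by
  induction t with
  | zero => rfl
  | succ t ih =>
    rw [← ih]
    simp only [A.load_succ, A.load_eq t, Finset.sum_add_distrib]
    rw [sum_neighborFinset_comm]

theorem load_eq_outflow (hd : 0 < d) (T : ℕ) (u : V) :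
    (A.load T u : ℝ) = A.load 0 u + (transition G d l *ᵥ A.outflow d T) u - A.outflow d T u +
      A.inflowError d T u := by
  have hD' : ((d + l : ℕ) : ℝ) ≠ 0 := by exact_mod_cast (by omega : d + l ≠ 0)
  have hP : ∀ T, (transition G d l *ᵥ A.outflow d T) u =
      ∑ t ∈ Finset.range T, (l * A.meanSend d t u +
        ∑ v ∈ G.neighborFinset u, A.meanSend d t v) := by
    intro T
    rw [transition_mulVec, div_eq_iff hD', Finset.sum_add_distrib, Finset.sum_comm (t := _)]
    simp only [outflow, ← Finset.mul_sum]
    ring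
  rw [hP]
  induction T with
  | zero => simp [outflow, inflowError]
  | succ T ih =>
    have h1 : (A.load (T + 1) u : ℝ) = A.load T u +
        (∑ v ∈ G.neighborFinset u, (A.send T v u : ℝ) -
          ∑ v ∈ G.neighborFinset u, (A.send T u v : ℝ)) := by
      rw [A.load_succ, A.load_eq]
      push_cast
      ring
    rw [h1, ih, ← mul_meanSend hd]
    simp only [outflow, inflowError, Finset.sum_range_succ, Finset.sum_sub_distrib]
    push_cast
    ring

theorem outflow_succ (hd : 0 < d) (T : ℕ) :
    A.outflow d (T + 1) = transition G d l *ᵥ A.outflow d T + (fun u => (A.load 0 u : ℝ)) +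
      fun u => A.inflowError d T u - A.remainder d T u := by
  ext u
  have h := load_eq_outflow (A := A) hd T u
  have h1 : A.outflow d (T + 1) u = A.outflow d T u + (d + l : ℕ) * A.meanSend d T u := by
    simp [outflow, Finset.sum_range_succ]
  simp only [Pi.add_apply, remainder]
  linarith

omit [DecidableEq V] in
theorem load_sub_le_discrepancy [Nonempty V] (x : V → ℕ) (u v : V) :
    (x u : ℝ) - x v ≤ discrepancy x := by
  have h1 := Finset.le_sup' x (Finset.mem_univ u)
  have h2 := Finset.inf'_le x (Finset.mem_univ v)
  have : x u ≤ discrepancy x + x v := by unfold discrepancy; omega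
  have : (x u : ℝ) ≤ discrepancy x + x v := by exact_mod_cast this
  linarith

/-- The average load of a node over a time window is close to the average load of all nodes. -/
theorem abs_sum_window_sub_le [Nonempty V] (hc : G.Connected) (hG : G.IsRegularOfDegree d)
    (hd : 0 < d) (hδ : 1 ≤ δ) (hgap : 0 < gap G d l) (hA : A.IsGoodBalancer d δ s) {m T : ℕ}
    (hm : Fintype.card V * (1 - gap G d l) ^ m ≤ 1)
    (hT : discrepancy (A.load 0) * (Fintype.card V * (1 - gap G d l) ^ T) ≤ 1) (W : ℕ) (u : V) :
    |∑ i ∈ Finset.range W, (A.load (T + i) u : ℝ) -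
        W * ((∑ v, (A.load 0 v : ℝ)) / Fintype.card V)| ≤
      2 * l * W + (4 * (δ * (d + l : ℕ)) * (m + 1 / gap G d l) + 1 / gap G d l) := by
  have hD : 0 < d + l := by omega
  have hn : (0 : ℝ) < Fintype.card V := by exact_mod_cast (Fintype.card_pos : 0 < Fintype.card V)
  have hr := fun t u => abs_le.1 (abs_remainder_le hG hd hA t u)
  have hε : ∀ T u, |A.inflowError d T u - A.remainder d T u| ≤ δ * (d + l : ℕ) := by
    intro T u
    have h1 := abs_le.1 (abs_inflowError_le hG hd (by linarith) hA T u)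
    have h2 := hr T u
    have h3 : (l : ℝ) ≤ δ * l := le_mul_of_one_le_left (by positivity) hδ
    push_cast
    rw [abs_le]
    constructor <;> linarith [h1.1, h1.2, h2.1, h2.2]
  have h := abs_center_sub_center_le (G := G) (d := d) (l := l) hc hG hD hgap (Z := A.outflow d)
    (by ext u; simp [outflow]) (outflow_succ hd) (load_sub_le_discrepancy (A.load 0)) hε hm hT W u
  have hz : ∀ u, A.outflow d (T + W) u - A.outflow d T u =
      ∑ i ∈ Finset.range W, ((A.load (T + i) u : ℝ) - A.remainder d (T + i) u) := by
    intro u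
    simp [outflow, remainder, Finset.sum_range_add]
  -- The total load is conserved, so the mean outflow over the window is `W` times the average load
  -- up to remainders.
  have hmean : (∑ v, A.outflow d (T + W) v) / Fintype.card V -
      (∑ v, A.outflow d T v) / Fintype.card V =
      W * ((∑ v, (A.load 0 v : ℝ)) / Fintype.card V) -
        ∑ i ∈ Finset.range W, (∑ v, A.remainder d (T + i) v) / Fintype.card V := by
    have hload : ∀ t, ∑ v, (A.load t v : ℝ) = ∑ v, (A.load 0 v : ℝ) := by
      intro t
      exact_mod_cast sum_load (A := A) t
    rw [← sub_div, ← Finset.sum_sub_distrib]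
    simp only [hz]
    rw [Finset.sum_comm]
    simp only [Finset.sum_sub_distrib, hload, Finset.sum_const, Finset.card_range, nsmul_eq_mul]
    rw [sub_div, mul_div_assoc, Finset.sum_div (Finset.range W)]
  have hrem : |∑ i ∈ Finset.range W, A.remainder d (T + i) u| ≤ l * W := by
    refine (Finset.abs_sum_le_sum_abs _ _).trans ?_
    have := Finset.sum_le_card_nsmul (Finset.range W) (fun i => |A.remainder d (T + i) u|) l
      fun i _ => abs_remainder_le hG hd hA _ u
    simpa [mul_comm] using this
  have hrem' : |∑ i ∈ Finset.range W, (∑ v, A.remainder d (T + i) v) / Fintype.card V| ≤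
      l * W := by
    refine (Finset.abs_sum_le_sum_abs _ _).trans ?_
    have := Finset.sum_le_card_nsmul (Finset.range W)
      (fun i => |(∑ v, A.remainder d (T + i) v) / Fintype.card V|) l fun i _ => by
        rw [abs_div, abs_of_pos hn, div_le_iff₀ hn]
        refine (Finset.abs_sum_le_sum_abs _ _).trans ?_
        have := Finset.sum_le_card_nsmul Finset.univ (fun v => |A.remainder d (T + i) v|) l
          fun v _ => abs_remainder_le hG hd hA _ v
        simpa [mul_comm] using this
    simpa [mul_comm] using this
  have hzu := hz u
  rw [Finset.sum_sub_distrib] at hzu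
  simp only [center] at h
  have h1 := abs_le.1 h
  have h2 := abs_le.1 hrem
  have h3 := abs_le.1 hrem'
  rw [abs_le]
  constructor <;> linarith [h1.1, h1.2, h2.1, h2.2, h3.1, h3.2]

end Execution

end LoadBalancing

/-! ### Excesses and deficits of a good balancer drain -/

namespace LoadBalancing

namespace Execution

variable {V : Type*} [Fintype V] {G : SimpleGraph V} [DecidableRel G.Adj]
  {d l s : ℕ} {δ : ℝ} {A : Execution G l}

theorem le_of_mul_le_load (hd : 0 < d) (hA : A.IsGoodBalancer d δ s) (t : ℕ) (u : V) {c : ℤ}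
    (hc : c * (d + l : ℕ) ≤ A.load t u) :
    (∀ v ∈ G.neighborFinset u, c ≤ A.send t u v) ∧ ∀ i, c ≤ A.keep t u i := by
  have h : c ≤ ((A.load t u / (d + l) : ℕ) : ℤ) := by
    rw [Int.natCast_div]
    exact (Int.le_ediv_iff_mul_le (by positivity)).2 hc
  obtain ⟨hs, hk, -⟩ := hA.fair t u
  exact ⟨fun v hv => h.trans (by exact_mod_cast hs v hv), fun i => h.trans (by exact_mod_cast hk i)⟩

theorem le_of_load_le_mul (hd : 0 < d) (hA : A.IsGoodBalancer d δ s) (t : ℕ) (u : V) {c : ℤ}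
    (hc : A.load t u ≤ c * (d + l : ℕ)) :
    (∀ v ∈ G.neighborFinset u, (A.send t u v : ℤ) ≤ c) ∧ ∀ i, (A.keep t u i : ℤ) ≤ c := by
  have hD : (0 : ℤ) < ((d + l : ℕ) : ℤ) := by exact_mod_cast (by omega : 0 < d + l)
  have hc0 : 0 ≤ c := by
    by_contra! h
    have := mul_neg_of_neg_of_pos h hD
    omega
  lift c to ℕ using hc0
  have h : A.load t u ⌈/⌉ (d + l) ≤ c := by
    rw [ceilDiv_le_iff_le_mul (by omega), mul_comm]
    exact_mod_cast hc
  obtain ⟨hs, hk⟩ := hA.roundsUpAtMost t u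
  exact ⟨fun v hv => by exact_mod_cast (hs v hv).trans h, fun i => by exact_mod_cast (hk i).trans h⟩

/-- From `(c + 1) * (d + l)` tokens on, each of the `l ≥ s` self-loops keeps at least `c + 1`. Below
that, `c` is the rounded-down share and self-preference applies. -/
theorem min_excess_le_keep (hd : 0 < d) (hsl : s ≤ l) (hA : A.IsGoodBalancer d δ s) (t : ℕ)
    (u : V) {c : ℤ} (hc : c * (d + l : ℕ) ≤ A.load t u) :
    min (s : ℤ) (A.load t u - c * (d + l : ℕ)) ≤ ∑ i, (A.keep t u i : ℤ) - l * c := by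
  have hD : (0 : ℤ) < ((d + l : ℕ) : ℤ) := by exact_mod_cast (by omega : 0 < d + l)
  rcases le_or_gt ((c + 1) * (d + l : ℕ)) (A.load t u : ℤ) with h | h
  · have h1 := Finset.card_nsmul_le_sum Finset.univ (fun i => (A.keep t u i : ℤ)) (c + 1)
      fun i _ => (le_of_mul_le_load hd hA t u h).2 i
    simp only [Finset.card_univ, Fintype.card_fin, nsmul_eq_mul] at h1
    have : (s : ℤ) ≤ l := by exact_mod_cast hsl
    have := min_le_left (s : ℤ) (A.load t u - c * (d + l : ℕ))
    linarith
  · set r : ℤ := A.load t u - c * (d + l : ℕ) with hr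
    have hrD : r < (d + l : ℕ) := by linarith
    have hmod : ((A.load t u % (d + l) : ℕ) : ℤ) = r := by
      rw [Int.natCast_mod, show (A.load t u : ℤ) = r + c * (d + l : ℕ) by omega,
        Int.add_mul_emod_self_right, Int.emod_eq_of_lt (by omega) hrD]
    -- With no excess the rounded-up share is `c` itself, so `c + 1 ≤ ⌈x / d⁺⌉` holds only for `r >
    -- 0`.
    rcases eq_or_lt_of_le (show 0 ≤ r by omega) with hr0 | hr0
    · have h1 := Finset.card_nsmul_le_sum Finset.univ (fun i => (A.keep t u i : ℤ)) c
        fun i _ => (le_of_mul_le_load hd hA t u hc).2 i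
      simp only [Finset.card_univ, Fintype.card_fin, nsmul_eq_mul] at h1
      have := min_le_right (s : ℤ) r
      linarith
    · have hceil : c + 1 ≤ ((A.load t u ⌈/⌉ (d + l) : ℕ) : ℤ) := by
        by_contra! hlt
        have h2 : A.load t u ≤ (d + l) * (A.load t u ⌈/⌉ (d + l)) :=
          (ceilDiv_le_iff_le_mul (by omega)).1 le_rfl
        have h3 : (A.load t u : ℤ) ≤ (d + l : ℕ) * ((A.load t u ⌈/⌉ (d + l) : ℕ) : ℤ) := by
          exact_mod_cast h2
        have h4 := mul_le_mul_of_nonneg_left (Int.lt_add_one_iff.1 hlt) hD.le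
        linarith
      have h1 := hA.selfPreferring t u
      have h2 : ((min s (A.load t u % (d + l)) : ℕ) : ℤ) ≤
          ((Finset.univ.filter fun i => A.keep t u i = A.load t u ⌈/⌉ (d + l)).card : ℤ) := by
        exact_mod_cast h1
      rw [Nat.cast_min, hmod, Finset.card_filter] at h2
      refine h2.trans ?_
      have h3 : ∑ i, (A.keep t u i : ℤ) - l * c = ∑ i, ((A.keep t u i : ℤ) - c) := by
        rw [Finset.sum_sub_distrib]
        simp
      rw [h3]
      push_cast
      refine Finset.sum_le_sum fun i _ => ?_
      have h4 := (le_of_mul_le_load hd hA t u hc).2 i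
      split_ifs with h5
      · rw [h5]; linarith
      · linarith

theorem sum_keep_le (hd : 0 < d) (hA : A.IsGoodBalancer d δ s) (t : ℕ) (u : V) {c : ℤ}
    (hc : A.load t u ≤ c * (d + l : ℕ)) : ∑ i, (A.keep t u i : ℤ) ≤ l * c := by
  have h := Finset.sum_le_card_nsmul Finset.univ (fun i => (A.keep t u i : ℤ)) c
    fun i _ => (le_of_load_le_mul hd hA t u hc).2 i
  simpa using h

theorem load_eq_sum_sub (hG : G.IsRegularOfDegree d) (t : ℕ) (u : V) (c : ℤ) :
    (A.load t u : ℤ) - c * (d + l : ℕ) =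
      ∑ v ∈ G.neighborFinset u, ((A.send t u v : ℤ) - c) +
        (∑ i, (A.keep t u i : ℤ) - l * c) := by
  rw [A.load_eq, Finset.sum_sub_distrib, Finset.sum_const, card_neighborFinset hG]
  push_cast
  simp only [nsmul_eq_mul]
  ring

theorem load_succ_eq_sum_sub (hG : G.IsRegularOfDegree d) (t : ℕ) (u : V) (c : ℤ) :
    (A.load (t + 1) u : ℤ) - c * (d + l : ℕ) =
      ∑ v ∈ G.neighborFinset u, ((A.send t v u : ℤ) - c) +
        (∑ i, (A.keep t u i : ℤ) - l * c) := by
  rw [A.load_succ, Finset.sum_sub_distrib, Finset.sum_const, card_neighborFinset hG]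
  push_cast
  simp only [nsmul_eq_mul]
  ring

/-- The excess of the loads over a multiple of the degree is draining. -/
theorem draining_load_sub (hG : G.IsRegularOfDegree d) (hd : 0 < d) (hsl : s ≤ l)
    (hA : A.IsGoodBalancer d δ s) (c : ℤ) :
    Draining ((d + l : ℕ) : ℤ) s fun t u => (A.load t u : ℤ) - c * (d + l : ℕ) := by
  intro j t
  simp only [sub_sub, ← add_mul]
  refine excess_step G (fun u v => (A.send t u v : ℤ) - (c + j))
    (fun u => ∑ i, (A.keep t u i : ℤ) - l * (c + j)) _ _ s (fun u => load_eq_sum_sub hG t u _)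
    (fun u => load_succ_eq_sum_sub hG t u _) (fun u hu => ?_) fun u hu => ?_
  · rw [sub_nonneg] at hu
    have h := min_excess_le_keep hd hsl hA t u hu
    refine ⟨fun v hv => sub_nonneg.2 ((le_of_mul_le_load hd hA t u hu).1 v hv), h, ?_⟩
    exact (le_min (by positivity) (sub_nonneg.2 hu)).trans h
  · rw [sub_nonpos] at hu
    exact ⟨fun v hv => sub_nonpos.2 ((le_of_load_le_mul hd hA t u hu).1 v hv),
      sub_nonpos.2 (sum_keep_le hd hA t u hu)⟩

/-- The deficit of the loads below a multiple of the degree plus `s` is draining. -/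
theorem draining_sub_load (hG : G.IsRegularOfDegree d) (hd : 0 < d) (hsl : s ≤ l)
    (hA : A.IsGoodBalancer d δ s) (c : ℤ) :
    Draining ((d + l : ℕ) : ℤ) s fun t u => c * (d + l : ℕ) + s - (A.load t u : ℤ) := by
  intro j t
  have hsl' : (s : ℤ) ≤ l := by exact_mod_cast hsl
  have hform : ∀ x : ℤ, c * (d + l : ℕ) + s - x - j * (d + l : ℕ) =
      s - (x - (c - j) * (d + l : ℕ)) := fun x => by ring
  simp only [hform]
  have hneg : ∀ f : V → ℤ, ∀ u, ∑ v ∈ G.neighborFinset u, ((c - j) - f v) =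
      - ∑ v ∈ G.neighborFinset u, (f v - (c - j)) := fun f u => by
    rw [← Finset.sum_neg_distrib]
    exact Finset.sum_congr rfl fun _ _ => by ring
  refine excess_step G (fun u v => (c - j) - (A.send t u v : ℤ))
    (fun u => s - (∑ i, (A.keep t u i : ℤ) - l * (c - j))) _ _ s (fun u => ?_) (fun u => ?_)
    (fun u hu => ?_) fun u hu => ?_
  · rw [load_eq_sum_sub hG, hneg fun v => (A.send t u v : ℤ)]
    ring
  · rw [load_succ_eq_sum_sub hG, hneg fun v => (A.send t v u : ℤ)]
    ring
  · rcases le_total (A.load t u : ℤ) ((c - j) * (d + l : ℕ)) with h | h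
    · have h1 := sum_keep_le hd hA t u h
      refine ⟨fun v hv => sub_nonneg.2 ((le_of_load_le_mul hd hA t u h).1 v hv), ?_, ?_⟩
      · exact (min_le_left _ _).trans (by linarith)
      · have : (0 : ℤ) ≤ s := by positivity
        linarith
    -- At most `s` excess tokens: self-preference puts them all on self-loops, so every original
    -- edge carries exactly `c - j`. The shift of the level by `s` is chosen for this case.
    · have h1 := min_excess_le_keep hd hsl hA t u h
      rw [min_eq_right (by linarith)] at h1
      have h2 := load_eq_sum_sub (A := A) hG t u (c - j)
      have h3 : ∀ v ∈ G.neighborFinset u, 0 ≤ (A.send t u v : ℤ) - (c - j) := fun v hv =>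
        sub_nonneg.2 ((le_of_mul_le_load hd hA t u h).1 v hv)
      have h4 := Finset.sum_nonneg h3
      have h5 := (Finset.sum_eq_zero_iff_of_nonneg h3).1 (by linarith)
      refine ⟨fun v hv => by linarith [h5 v hv], ?_, by linarith⟩
      exact (min_le_right _ _).trans (by linarith)
  · have h0 : (0 : ℤ) ≤ s := by positivity
    have h : (c - j) * (d + l : ℕ) ≤ (A.load t u : ℤ) := by linarith
    have h1 := min_excess_le_keep hd hsl hA t u h
    rw [min_eq_left (by linarith)] at h1
    exact ⟨fun v hv => sub_nonpos.2 ((le_of_mul_le_load hd hA t u h).1 v hv), by linarith⟩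

end Execution

/-! ### Dyadic descent of the threshold -/

namespace Draining

variable {V : Type*} [Fintype V] {D s : ℤ} {y : ℕ → V → ℤ}

/-- Phase `i` starts below `2 ^ (i + 1) * D`; shifted by `2 ^ i * D`, this is the window argument
with `m = 2 ^ i`. The phases run from the largest `i` downwards. -/
theorem le_of_dyadic_windows (hs : 0 ≤ s) (hsD : s ≤ D) (hD : 0 < D) (hy : Draining D s y)
    (N W : ℕ → ℕ)
    (hN : ∀ i, (1 - (s : ℝ) / (2 * D)) ^ N i * (Fintype.card V * D * 4 ^ 2 ^ i) < 1) (I t₀ : ℕ)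
    (hW : ∀ i < I, ∀ t ≥ t₀, ∀ u, ∃ j ≤ W i, y (t + j) u ≤ 2 ^ i * D)
    (h₀ : ∀ u, y t₀ u ≤ 2 ^ I * D) {t : ℕ}
    (ht : t₀ + ∑ i ∈ Finset.range I, N i * W i ≤ t) (u : V) : y t u ≤ D := by
  induction I generalizing t₀ with
  | zero =>
    have := hy.le_of_le 1 (t₀ := t₀) (t := t) (by simpa using ht) (by simpa using h₀) u
    simpa using this
  | succ I ih =>
    rw [Finset.sum_range_succ] at ht
    refine ih (t₀ + N I * W I)
      (fun i hi t ht => hW i (by omega) t (le_trans (Nat.le_add_right _ _) ht)) ?_ (by omega)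
    intro u
    have h := (hy.shift (2 ^ I)).nonpos_of_windows hs hsD hD (2 ^ I) t₀ (W I) (fun u => ?_)
      (by positivity) (fun t ht u => ?_) (N I) (hN I) le_rfl u
    · push_cast at h
      linarith
    · have := h₀ u
      push_cast
      rw [pow_succ] at this
      linarith
    · obtain ⟨j, hj, h⟩ := hW I (by omega) t ht u
      exact ⟨j, hj, by push_cast; linarith⟩

/-- If windows of length about `b / k` suffice to visit the level `k * D`, then a draining quantity
that starts from level `O(b)` is nonpositive after the stated time. -/
theorem nonpos_of_window_bound [Nonempty V] (hs : 1 ≤ s) (hsD : s ≤ D) (hy : Draining D s y)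
    {b : ℝ} (hb : 1 ≤ b) {I t₀ : ℕ} (hI : 2 ^ I ≤ 2 * b)
    (hwin : ∀ k W : ℕ, b ≤ W * (k + 1 / 2) → ∀ t ≥ t₀, ∀ u, ∃ j ≤ W, y (t + j) u ≤ k * D)
    (h₀ : ∀ u, y t₀ u ≤ 2 ^ I * D) {t : ℕ}
    (ht : t₀ + b * (2 * D / s) * (7 * (Real.log (Fintype.card V) + Real.log D + 1) + 4 * I + 6) ≤ t)
    (u : V) : y t u ≤ 0 := by
  have hD : 0 < D := by omega
  have hs' : (1 : ℝ) ≤ s := by exact_mod_cast hs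
  have hsD' : (s : ℝ) ≤ D := by exact_mod_cast hsD
  have hD' : (1 : ℝ) ≤ D := hs'.trans hsD'
  have hn : (1 : ℝ) ≤ Fintype.card V := by exact_mod_cast (Fintype.card_pos : 0 < Fintype.card V)
  set R : ℝ := 2 * D / s with hR
  have hR2 : 2 ≤ R := by
    rw [hR, le_div_iff₀ (by linarith)]; linarith
  set Λ : ℝ := Real.log (Fintype.card V) + Real.log D + 1 with hΛ
  have hΛ1 : 1 ≤ Λ := by
    have := Real.log_nonneg hn
    have := Real.log_nonneg hD'
    linarith
  have hlog4 : Real.log 4 ≤ 2 := by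
    rw [show (4 : ℝ) = 2 ^ 2 by norm_num, Real.log_pow]
    have := Real.log_two_lt_d9
    push_cast
    linarith
  -- Each window contracts by at most `exp (-1 / R)`, so `R` times the logarithm of the initial
  -- bound `n * D * 4 ^ 2 ^ i` suffices; the `+ 1` makes the inequality strict.
  set N : ℕ → ℕ := fun i => ⌈R * (Λ - 1 + 2 ^ i * Real.log 4)⌉₊ + 1 with hNdef
  have hN : ∀ i, (1 - (s : ℝ) / (2 * D)) ^ N i * (Fintype.card V * D * 4 ^ 2 ^ i) < 1 := by
    intro i
    have h1 : R * (Λ - 1 + 2 ^ i * Real.log 4) < N i := by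
      rw [hNdef]
      push_cast
      linarith [Nat.le_ceil (R * (Λ - 1 + 2 ^ i * Real.log 4))]
    have h2 : (Fintype.card V : ℝ) * D * 4 ^ 2 ^ i = Real.exp (Λ - 1 + 2 ^ i * Real.log 4) := by
      have h3 : Λ - 1 + 2 ^ i * Real.log 4 = Real.log (Fintype.card V * D * 4 ^ 2 ^ i) := by
        rw [Real.log_mul (by positivity) (by positivity), Real.log_mul (by positivity)
          (by positivity), Real.log_pow]
        push_cast
        ring
      rw [h3, Real.exp_log (by positivity)]
    have h3 : (1 - (s : ℝ) / (2 * D)) ^ N i ≤ Real.exp (-(N i / R)) := by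
      have h4 : 1 - (s : ℝ) / (2 * D) ≤ Real.exp (-(1 / R)) := by
        have := Real.add_one_le_exp (-(1 / R))
        rw [hR, one_div_div] at this ⊢
        linarith
      have h5 : 0 ≤ 1 - (s : ℝ) / (2 * D) := by
        rw [sub_nonneg, div_le_one (by positivity)]; linarith
      refine (pow_le_pow_left₀ h5 h4 _).trans (le_of_eq ?_)
      rw [← Real.exp_nat_mul]
      congr 1
      ring
    rw [h2]
    refine (mul_le_mul_of_nonneg_right h3 (Real.exp_pos _).le).trans_lt ?_
    rw [← Real.exp_add, Real.exp_lt_one_iff]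
    have : Λ - 1 + 2 ^ i * Real.log 4 < N i / R := by
      rw [lt_div_iff₀ (by linarith)]; linarith
    linarith
  have hNle : ∀ i, (N i : ℝ) ≤ R * (Λ + 2 * 2 ^ i) := by
    intro i
    have h0 : (0 : ℝ) ≤ 2 ^ i * Real.log 4 :=
      mul_nonneg (by positivity) (Real.log_nonneg (by norm_num))
    have h1 := Nat.ceil_lt_add_one (a := R * (Λ - 1 + 2 ^ i * Real.log 4))
      (mul_nonneg (by linarith) (by linarith))
    have h2 : (2 : ℝ) ^ i * Real.log 4 ≤ 2 * 2 ^ i := by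
      rw [mul_comm]; gcongr
    have h3 : R * (Λ - 1 + 2 ^ i * Real.log 4) ≤ R * (Λ - 1 + 2 * 2 ^ i) := by gcongr
    rw [hNdef]
    push_cast
    linarith
  set W : ℕ → ℕ := fun i => ⌈b / 2 ^ i⌉₊ with hWdef
  have hWle : ∀ i < I, (W i : ℝ) ≤ 2 * b / 2 ^ i := by
    intro i hi
    have h1 := Nat.ceil_lt_add_one (a := b / 2 ^ i) (by positivity)
    have h2 : (2 : ℝ) ^ i ≤ b := by
      have h3 : (2 : ℝ) ^ (i + 1) ≤ 2 ^ I := pow_le_pow_right₀ (by norm_num) hi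
      rw [pow_succ] at h3
      linarith
    have h3 : 1 ≤ b / 2 ^ i := by rwa [le_div_iff₀ (by positivity), one_mul]
    rw [mul_div_assoc]
    simp only [hWdef]
    linarith
  -- In `N i * W i` the factor `2 ^ i` in `N i` cancels against the window length and gives a
  -- constant per phase, while the `Λ` terms form a geometric series.
  have hsum : ∀ J ≤ I, ∑ i ∈ Finset.range J, (N i * W i : ℝ) ≤
      2 * b * R * (2 * Λ * (1 - 1 / 2 ^ J) + 2 * J) := by
    intro J hJ
    induction J with
    | zero => simp
    | succ J ih =>
      rw [Finset.sum_range_succ]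
      have h1 : (N J * W J : ℝ) ≤ R * (Λ + 2 * 2 ^ J) * (2 * b / 2 ^ J) :=
        mul_le_mul (hNle J) (hWle J (by omega)) (by positivity) (by positivity)
      refine (add_le_add (ih (by omega)) h1).trans (le_of_eq ?_)
      push_cast
      field_simp
      ring
  have hsumI : ((∑ i ∈ Finset.range I, N i * W i : ℕ) : ℝ) ≤ 2 * b * R * (2 * Λ + 2 * I) := by
    push_cast
    refine (hsum I le_rfl).trans ?_
    have : 2 * Λ * (1 - 1 / 2 ^ I) ≤ 2 * Λ :=
      mul_le_of_le_one_right (by linarith) (by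
        have : (0 : ℝ) ≤ 1 / 2 ^ I := by positivity
        linarith)
    have : 0 ≤ 2 * b * R := by positivity
    gcongr
  have hone : ∀ t ≥ t₀ + ∑ i ∈ Finset.range I, N i * W i, ∀ u, y t u ≤ D := fun t ht u =>
    hy.le_of_dyadic_windows (by omega) hsD hD N W hN I t₀ (fun i _ t ht u => by
      have h1 : b ≤ W i * ((2 ^ i : ℕ) + 1 / 2) := by
        have h2 : b / 2 ^ i ≤ W i := Nat.le_ceil _
        rw [div_le_iff₀ (by positivity)] at h2
        push_cast
        have : (0 : ℝ) ≤ W i := by positivity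
        linarith
      simpa using hwin (2 ^ i) (W i) h1 t ht u) h₀ ht u
  have hW' : (⌈2 * b⌉₊ : ℝ) ≤ 3 * b := by
    have := Nat.ceil_lt_add_one (a := 2 * b) (by positivity)
    linarith
  -- The last phase goes from `D` to `0`: with `k = 0` the slack `1 / 2` in `hwin` still permits
  -- windows of length `2 * b`.
  refine hy.nonpos_of_windows (by omega) hsD hD 1 (t₀ + ∑ i ∈ Finset.range I, N i * W i) ⌈2 * b⌉₊
    (fun u => by simpa using hone _ le_rfl u) one_pos (fun t ht u => ?_) (N 0)
    (by simpa using hN 0) ?_ u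
  · have h1 : b ≤ ⌈2 * b⌉₊ * ((0 : ℕ) + 1 / 2) := by
      have := Nat.le_ceil (2 * b)
      push_cast
      linarith
    simpa using hwin 0 _ h1 t (le_trans (Nat.le_add_right _ _) ht) u
  · have h1 : (N 0 * ⌈2 * b⌉₊ : ℝ) ≤ R * (Λ + 2) * (3 * b) := by
      have := hNle 0
      rw [pow_zero, mul_one] at this
      exact mul_le_mul this hW' (by positivity) (by positivity)
    have h2 : ((t₀ + ∑ i ∈ Finset.range I, N i * W i + N 0 * ⌈2 * b⌉₊ : ℕ) : ℝ) ≤ t := by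
      push_cast at hsumI ⊢
      refine le_trans ?_ ht
      have h3 : b * R * (7 * Λ + 4 * I + 6) =
          2 * b * R * (2 * Λ + 2 * I) + R * (Λ + 2) * (3 * b) := by ring
      linarith
    exact_mod_cast h2

end Draining

end LoadBalancing

/-! ### Time estimates and the final bound -/

namespace LoadBalancing

theorem two_thirds_le_log {n : ℝ} (hn : 2 ≤ n) : 2 / 3 ≤ Real.log n := by
  have h1 := Real.log_le_log (by norm_num) hn
  have h2 := Real.log_two_gt_d9
  linarith

/-- Both `log D` and `I` are `O(log n)`: `D ≤ (1 + κ) n` and `1 / μ ≤ 2 (1 + κ) n ^ 3`, so `b ≤ 40 δ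
(1 + κ) n ^ 4`. The constant is `4000 = 20 * 2 * 100`, from `b`, `2 * D / s` and `hX`. -/
theorem balancing_time_le {δ κ n d D s μ b : ℝ} (hδ : 1 ≤ δ) (hκ : 0 ≤ κ) (hn : 2 ≤ n)
    (hd : 0 < d) (hdn : d ≤ n) (hD1 : 1 ≤ D) (hD : D ≤ (1 + κ) * d) (hs : 0 < s) (hμ : 0 < μ)
    (hμ' : 1 / (2 * D * n ^ 2) ≤ μ) (hb : b = 20 * δ * (Real.log n / μ)) (hb1 : 1 ≤ b) {I : ℕ}
    (hI : 2 ^ I ≤ 2 * b) :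
    b * (2 * D / s) * (7 * (Real.log n + Real.log D + 1) + 4 * I + 6) ≤
      4000 * δ * (1 + κ) * (1 + Real.log (40 * δ * (1 + κ))) * (d / s * Real.log n ^ 2 / μ) := by
  set ℓ := Real.log n with hℓ
  set Q := Real.log (40 * δ * (1 + κ)) with hQ
  have hD0 : 0 < D := by linarith
  have hlogD0 : 0 ≤ Real.log D := Real.log_nonneg hD1
  have hℓ0 : 2 / 3 ≤ ℓ := two_thirds_le_log hn
  have h40 : 1 ≤ 40 * δ * (1 + κ) := by nlinarith [mul_nonneg (by linarith : 0 ≤ δ) hκ]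
  have hQ0 : 0 ≤ Q := Real.log_nonneg h40
  have hlogD : Real.log D ≤ ℓ + Q := by
    rw [hℓ, hQ, ← Real.log_mul (by linarith) (by linarith)]
    refine Real.log_le_log hD0 ?_
    have h1 : D ≤ (1 + κ) * n := hD.trans (by gcongr)
    have h2 : (1 + κ) * n ≤ δ * ((1 + κ) * n) := le_mul_of_one_le_left (by positivity) hδ
    have h3 : 0 ≤ δ * ((1 + κ) * n) := by positivity
    linarith
  have hμinv : 1 / μ ≤ 2 * (1 + κ) * n ^ 3 := by
    have h1 : 1 / μ ≤ 2 * D * n ^ 2 := by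
      rw [one_div_le hμ (by positivity)]; exact hμ'
    refine h1.trans ?_
    have : D ≤ (1 + κ) * n := hD.trans (by gcongr)
    nlinarith [mul_le_mul_of_nonneg_right this (by positivity : 0 ≤ n ^ 2)]
  have hlogb : Real.log b ≤ Q + 4 * ℓ := by
    have h1 : Q + 4 * ℓ = Real.log (40 * δ * (1 + κ) * n ^ 4) := by
      rw [Real.log_mul (by linarith) (by positivity), Real.log_pow]
      push_cast
      ring
    rw [h1]
    refine Real.log_le_log (by linarith) ?_
    have h2 : ℓ ≤ n := (Real.log_le_sub_one_of_pos (by linarith)).trans (by linarith)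
    rw [hb, div_eq_mul_one_div]
    calc 20 * δ * (ℓ * (1 / μ)) ≤ 20 * δ * (n * (2 * (1 + κ) * n ^ 3)) := by gcongr
      _ = _ := by ring
  have hI' : (I : ℝ) ≤ 3 / 2 * (Q + 4 * ℓ) + 3 / 2 := by
    have h1 : I * Real.log 2 ≤ Real.log 2 + Real.log b := by
      rw [← Real.log_pow, ← Real.log_mul (by norm_num) (by linarith)]
      exact Real.log_le_log (by positivity) hI
    have h2 := Real.log_two_lt_d9
    have h3 : I * (2 / 3 : ℝ) ≤ I * Real.log 2 := by
      gcongr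
      exact two_thirds_le_log le_rfl
    linarith
  have hQℓ : Q ≤ 3 / 2 * (Q * ℓ) := by nlinarith
  have hX : 7 * (ℓ + Real.log D + 1) + 4 * I + 6 ≤ 100 * (1 + Q) * ℓ := by nlinarith
  have hR : 2 * D / s ≤ 2 * (1 + κ) * (d / s) := by
    rw [mul_div_assoc', div_le_div_iff_of_pos_right hs]; linarith
  calc b * (2 * D / s) * (7 * (ℓ + Real.log D + 1) + 4 * I + 6)
      ≤ b * (2 * (1 + κ) * (d / s)) * (100 * (1 + Q) * ℓ) := by gcongr
    _ = _ := by rw [hb]; ring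

theorem mul_one_sub_pow_le_one {x μ : ℝ} (hx : 0 < x) (hμ1 : μ ≤ 1) {T : ℕ}
    (hT : Real.log x ≤ μ * T) : x * (1 - μ) ^ T ≤ 1 := by
  have h1 : 1 - μ ≤ Real.exp (-μ) := by linarith [Real.add_one_le_exp (-μ)]
  have h2 : (1 - μ) ^ T ≤ Real.exp (-(μ * T)) := by
    refine (pow_le_pow_left₀ (by linarith) h1 T).trans (le_of_eq ?_)
    rw [← Real.exp_nat_mul]
    congr 1
    ring
  calc x * (1 - μ) ^ T ≤ x * Real.exp (-(μ * T)) := by gcongr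
    _ = Real.exp (Real.log x - μ * T) := by
        rw [sub_eq_add_neg, Real.exp_add, Real.exp_log hx]
    _ ≤ 1 := by rw [Real.exp_le_one_iff]; linarith

namespace Execution

variable {V : Type*} [DecidableEq V] [Fintype V] [Nonempty V] {G : SimpleGraph V}
  [DecidableRel G.Adj] {d l s : ℕ} {δ : ℝ} {A : Execution G l}

/-- The average load per node. -/
noncomputable def averageLoad (A : Execution G l) : ℝ :=
  (∑ v, (A.load 0 v : ℝ)) / Fintype.card V

theorem abs_sum_window_sub_averageLoad_le (hc : G.Connected) (hG : G.IsRegularOfDegree d)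
    (hd : 0 < d) (hδ : 1 ≤ δ) (hgap : 0 < gap G d l) (hA : A.IsGoodBalancer d δ s)
    (hn : 2 ≤ Fintype.card V) {T : ℕ}
    (hT : (Real.log (discrepancy (A.load 0)) + Real.log (Fintype.card V)) / gap G d l ≤ T)
    (W : ℕ) (u : V) :
    |∑ i ∈ Finset.range W, (A.load (T + i) u : ℝ) - W * A.averageLoad| ≤
      2 * l * W + 20 * δ * (Real.log (Fintype.card V) / gap G d l) * (d + l : ℕ) := by
  have hn' : (2 : ℝ) ≤ Fintype.card V := by exact_mod_cast hn
  have hlog := two_thirds_le_log hn'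
  set ℓ := Real.log (Fintype.card V)
  set μ := gap G d l
  have hμ1 : μ ≤ 1 := gap_le_one G d l
  have hm := Nat.le_ceil (ℓ / μ)
  have hm' := Nat.ceil_lt_add_one (a := ℓ / μ) (by positivity)
  have h1 : Fintype.card V * (1 - μ) ^ ⌈ℓ / μ⌉₊ ≤ 1 :=
    mul_one_sub_pow_le_one (by linarith) hμ1 (by rwa [div_le_iff₀' hgap] at hm)
  have h2 : discrepancy (A.load 0) * (Fintype.card V * (1 - μ) ^ T) ≤ 1 := by
    -- For zero discrepancy `Real.log` takes the value `0` and says nothing, but the product to be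
    -- bounded is `0`.
    rcases Nat.eq_zero_or_pos (discrepancy (A.load 0)) with h0 | h0
    · simp [h0]
    · have h0' : (0 : ℝ) < discrepancy (A.load 0) := by exact_mod_cast h0
      rw [← mul_assoc]
      refine mul_one_sub_pow_le_one (by positivity) hμ1 ?_
      rw [Real.log_mul h0'.ne' (by linarith)]
      rwa [div_le_iff₀' hgap] at hT
  refine (abs_sum_window_sub_le hc hG hd hδ hgap hA h1 h2 W u).trans ?_
  have hD : (1 : ℝ) ≤ (d + l : ℕ) := by exact_mod_cast (by omega : 1 ≤ d + l)
  set D : ℝ := ((d + l : ℕ) : ℝ)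
  have h3 : 1 / μ ≤ 3 / 2 * (ℓ / μ) := by
    rw [mul_div_assoc', div_le_div_iff_of_pos_right hgap]; linarith
  have h4 : 1 ≤ 1 / μ := by rwa [le_div_iff₀ hgap, one_mul]
  have h5 : ⌈ℓ / μ⌉₊ + 1 / μ ≤ 4 * (ℓ / μ) := by linarith
  have hδD : 1 ≤ δ * D := by nlinarith
  have h6 : 4 * (δ * D) * (⌈ℓ / μ⌉₊ + 1 / μ) ≤ 4 * (δ * D) * (4 * (ℓ / μ)) := by gcongr
  have h7 : 3 / 2 * (ℓ / μ) ≤ δ * D * (3 / 2 * (ℓ / μ)) :=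
    le_mul_of_one_le_left (by positivity) hδD
  have h8 : 0 ≤ δ * D * (ℓ / μ) := by positivity
  linarith

/-- If the load were outside the bound throughout the window, its sum would contradict the window
average; `hkW` absorbs the error term. -/
theorem exists_load_le (hc : G.Connected) (hG : G.IsRegularOfDegree d)
    (hd : 0 < d) (hδ : 1 ≤ δ) (hgap : 0 < gap G d l) (hA : A.IsGoodBalancer d δ s)
    (hn : 2 ≤ Fintype.card V) {T : ℕ}
    (hT : (Real.log (discrepancy (A.load 0)) + Real.log (Fintype.card V)) / gap G d l ≤ T)
    {k W : ℕ} (hW : 0 < W)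
    (hkW : 20 * δ * (Real.log (Fintype.card V) / gap G d l) ≤ W * (k + 1 / 2)) (u : V) :
    (∃ i < W, (A.load (T + i) u : ℝ) ≤ A.averageLoad + 2 * l + (k + 1 / 2) * (d + l : ℕ)) ∧
    ∃ i < W, A.averageLoad - 2 * l - (k + 1 / 2) * (d + l : ℕ) ≤ (A.load (T + i) u : ℝ) := by
  have h := abs_le.1 (abs_sum_window_sub_averageLoad_le hc hG hd hδ hgap hA hn hT W u)
  have h1 := mul_le_mul_of_nonneg_right hkW (Nat.cast_nonneg (α := ℝ) (d + l))
  have hne : (Finset.range W).Nonempty := Finset.nonempty_range_iff.2 hW.ne'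
  constructor
  · by_contra! hcon
    have h2 := Finset.sum_lt_sum_of_nonempty hne fun i hi => hcon i (Finset.mem_range.1 hi)
    rw [Finset.sum_const, Finset.card_range, nsmul_eq_mul] at h2
    linarith [h.2]
  · by_contra! hcon
    have h2 := Finset.sum_lt_sum_of_nonempty hne fun i hi => hcon i (Finset.mem_range.1 hi)
    rw [Finset.sum_const, Finset.card_range, nsmul_eq_mul] at h2
    linarith [h.1]

theorem load_sub_load_le (hc : G.Connected) (hG : G.IsRegularOfDegree d)
    (hd : 0 < d) (hδ : 1 ≤ δ) (hgap : 0 < gap G d l) (hs : 1 ≤ s) (hsl : s ≤ l)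
    (hA : A.IsGoodBalancer d δ s) (hn : 2 ≤ Fintype.card V) {T : ℕ}
    (hT : (Real.log (discrepancy (A.load 0)) + Real.log (Fintype.card V)) / gap G d l ≤ T)
    {b : ℝ} (hb : b = 20 * δ * (Real.log (Fintype.card V) / gap G d l)) (hb1 : 1 ≤ b) {I : ℕ}
    (hI1 : b ≤ 2 ^ I) (hI2 : 2 ^ I ≤ 2 * b) {t : ℕ}
    (ht : T + b * (2 * (d + l : ℕ) / s) *
      (7 * (Real.log (Fintype.card V) + Real.log (d + l : ℕ) + 1) + 4 * I + 6) ≤ t) (u v : V) :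
    (A.load t u : ℝ) - A.load t v ≤ 3 * (d + l : ℕ) + 4 * l := by
  have hs' : (1 : ℤ) ≤ s := by exact_mod_cast hs
  have hsD : (s : ℤ) ≤ (d + l : ℕ) := by exact_mod_cast (by omega : s ≤ d + l)
  have hD' : (0 : ℝ) < (d + l : ℕ) := by exact_mod_cast (by omega : 0 < d + l)
  have hvisit : ∀ {k W : ℕ}, 0 < W → b ≤ W * (k + 1 / 2) → ∀ t ≥ T, ∀ u,
      (∃ i < W, (A.load (t + i) u : ℝ) ≤ A.averageLoad + 2 * l + (k + 1 / 2) * (d + l : ℕ)) ∧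
      ∃ i < W, A.averageLoad - 2 * l - (k + 1 / 2) * (d + l : ℕ) ≤ (A.load (t + i) u : ℝ) := by
    intro k W hW hkW t ht u
    exact exists_load_le hc hG hd hδ hgap hA hn (hT.trans (by exact_mod_cast ht)) hW
      (by rwa [← hb]) u
  have hWpos : ∀ {k W : ℕ}, b ≤ W * (k + 1 / 2) → 0 < W := by
    intro k W h
    rcases Nat.eq_zero_or_pos W with rfl | hW
    · norm_num at h
      linarith
    · exact hW
  -- A window of length `1` already reaches level `2 ^ I`, so the starting bound of the descent
  -- holds at time `T` itself.
  have hone : b ≤ (1 : ℕ) * ((2 ^ I : ℕ) + 1 / 2) := by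
    push_cast
    linarith
  have hpow : ((2 ^ I : ℕ) : ℤ) = 2 ^ I := by push_cast; rfl
  set D : ℕ := d + l with hDdef
  -- Draining is available only at multiples of `D`. The term `1 / 2` pays for the slack in
  -- `hvisit`, and rounding costs at most another `D`, hence `3 / 2 * D` on either side of the mean.
  set c : ℤ := ⌈(A.averageLoad + 2 * l) / D + 1 / 2⌉ with hcdef
  have hc1 : A.averageLoad + 2 * l + 1 / 2 * D ≤ c * D := by
    have := Int.le_ceil ((A.averageLoad + 2 * l) / D + 1 / 2)
    rw [← hcdef, ← sub_nonneg, ← mul_nonneg_iff_of_pos_right hD'] at this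
    have h2 : ((c : ℝ) - ((A.averageLoad + 2 * l) / D + 1 / 2)) * D =
      c * D - (A.averageLoad + 2 * l + 1 / 2 * D) := by field_simp
    linarith
  have hc2 : c * D < A.averageLoad + 2 * l + 3 / 2 * D := by
    have := Int.ceil_lt_add_one ((A.averageLoad + 2 * l) / D + 1 / 2)
    rw [← hcdef, ← sub_pos, ← mul_pos_iff_of_pos_right hD'] at this
    have h2 : ((A.averageLoad + 2 * l) / D + 1 / 2 + 1 - (c : ℝ)) * D =
      A.averageLoad + 2 * l + 3 / 2 * D - c * D := by field_simp; ring
    linarith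
  set c' : ℤ := ⌊(A.averageLoad - 2 * l - s) / D - 1 / 2⌋ with hc'def
  have hc'1 : c' * D + s ≤ A.averageLoad - 2 * l - 1 / 2 * D := by
    have := Int.floor_le ((A.averageLoad - 2 * l - s) / D - 1 / 2)
    rw [← hc'def, ← sub_nonneg, ← mul_nonneg_iff_of_pos_right hD'] at this
    have h2 : ((A.averageLoad - 2 * l - s) / D - 1 / 2 - (c' : ℝ)) * D =
      A.averageLoad - 2 * l - 1 / 2 * D - (c' * D + s) := by field_simp; ring
    linarith
  have hc'2 : A.averageLoad - 2 * l - 3 / 2 * D < c' * D + s := by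
    have := Int.lt_floor_add_one ((A.averageLoad - 2 * l - s) / D - 1 / 2)
    rw [← hc'def, ← sub_pos, ← mul_pos_iff_of_pos_right hD'] at this
    have h2 : ((c' : ℝ) + 1 - ((A.averageLoad - 2 * l - s) / D - 1 / 2)) * D =
      c' * D + s - (A.averageLoad - 2 * l - 3 / 2 * D) := by field_simp; ring
    linarith
  have hup : ∀ k W : ℕ, b ≤ W * (k + 1 / 2) → ∀ t ≥ T, ∀ u, ∃ j < W,
      (A.load (t + j) u : ℤ) - c * D ≤ k * D := by
    intro k W hkW t ht u
    obtain ⟨j, hj, h⟩ := (hvisit (hWpos hkW) hkW t ht u).1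
    refine ⟨j, hj, ?_⟩
    have : (A.load (t + j) u : ℝ) - c * D ≤ k * D := by linarith
    exact_mod_cast this
  have hlow : ∀ k W : ℕ, b ≤ W * (k + 1 / 2) → ∀ t ≥ T, ∀ u, ∃ j < W,
      c' * D + s - (A.load (t + j) u : ℤ) ≤ k * D := by
    intro k W hkW t ht u
    obtain ⟨j, hj, h⟩ := (hvisit (hWpos hkW) hkW t ht u).2
    refine ⟨j, hj, ?_⟩
    have : c' * D + s - (A.load (t + j) u : ℝ) ≤ k * D := by linarith
    exact_mod_cast this
  have h1 := (draining_load_sub hG hd hsl hA c).nonpos_of_window_bound hs' hsD hb1 hI2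
    (fun k W hkW t ht u => (hup k W hkW t ht u).imp fun j hj => ⟨hj.1.le, hj.2⟩)
    (fun u => by
      obtain ⟨j, hj, h⟩ := hup _ 1 hone T le_rfl u
      obtain rfl : j = 0 := by omega
      rwa [hpow, add_zero] at h) (by simpa only [Int.cast_natCast] using ht) u
  have h2 := (draining_sub_load hG hd hsl hA c').nonpos_of_window_bound hs' hsD hb1 hI2
    (fun k W hkW t ht u => (hlow k W hkW t ht u).imp fun j hj => ⟨hj.1.le, hj.2⟩)
    (fun u => by
      obtain ⟨j, hj, h⟩ := hlow _ 1 hone T le_rfl u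
      obtain rfl : j = 0 := by omega
      rwa [hpow, add_zero] at h) (by simpa only [Int.cast_natCast] using ht) v
  have h1' : (A.load t u : ℝ) - c * D ≤ 0 := by exact_mod_cast h1
  have h2' : c' * D + s - (A.load t v : ℝ) ≤ 0 := by exact_mod_cast h2
  linarith

end Execution

theorem exists_load_sub_eq_discrepancy {V : Type*} [Fintype V] [Nonempty V] (x : V → ℕ) :
    ∃ u v, (discrepancy x : ℝ) = (x u : ℝ) - x v := by
  obtain ⟨u, -, hu⟩ := Finset.exists_mem_eq_sup' Finset.univ_nonempty x
  obtain ⟨v, -, hv⟩ := Finset.exists_mem_eq_inf' Finset.univ_nonempty x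
  refine ⟨u, v, ?_⟩
  rw [discrepancy, hv, hu, Nat.cast_sub]
  rw [← hu]
  exact Finset.le_sup' x (Finset.mem_univ v)

end LoadBalancing

theorem theorem2 (δ : ℝ) (hδ : 1 ≤ δ) (κ : ℝ) :
    ∃ C : ℝ, 0 < C ∧
      ∀ (V : Type*) [Fintype V] [DecidableEq V] [Nonempty V]
        (G : SimpleGraph V) [DecidableRel G.Adj] (d l s : ℕ),
        G.Connected → G.IsRegularOfDegree d → (l : ℝ) ≤ κ * d → 1 ≤ s → s ≤ l →
        ∀ A : LoadBalancing.Execution G l, A.IsGoodBalancer d δ s →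
          ∀ t : ℕ,
            C * ((Real.log (LoadBalancing.discrepancy (A.load 0)) +
                  Real.log (Fintype.card V)) / LoadBalancing.gap G d l +
                (d : ℝ) / s * Real.log (Fintype.card V) ^ 2 / LoadBalancing.gap G d l) ≤ t →
            (LoadBalancing.discrepancy (A.load t) : ℝ) ≤
              (2 * δ + 1) * ((d + l : ℕ) : ℝ) + 4 * (l : ℝ) := by
  -- The constant is fixed before any graph is given, so `κ` may still be negative here.
  set κ' := max κ 0 with hκ'
  have hκ0 : 0 ≤ κ' := le_max_right _ _
  have hQ : 0 ≤ Real.log (40 * δ * (1 + κ')) := Real.log_nonneg (by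
    nlinarith [mul_nonneg (by linarith : 0 ≤ δ) hκ0])
  refine ⟨4000 * δ * (1 + κ') * (1 + Real.log (40 * δ * (1 + κ'))), by positivity, ?_⟩
  intro V _ _ _ G _ d l s hc hG hl hs hsl A hA t ht
  -- Degree `0` would force `l = 0`, against `1 ≤ s ≤ l`. Thus there are at least two nodes and `log
  -- n` is bounded away from `0`.
  have hd : 0 < d := by
    rcases Nat.eq_zero_or_pos d with rfl | hd
    · have : (1 : ℝ) ≤ l := by exact_mod_cast hs.trans hsl
      norm_num at hl
      linarith
    · exact hd
  have hdn : d < Fintype.card V := by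
    obtain ⟨u⟩ := ‹Nonempty V›
    rw [← hG u]
    exact G.degree_lt_card_verts u
  have hn : 2 ≤ Fintype.card V := by omega
  have hn' : (2 : ℝ) ≤ Fintype.card V := by exact_mod_cast hn
  have hd' : (0 : ℝ) < d := by exact_mod_cast hd
  have hs' : (0 : ℝ) < s := by exact_mod_cast hs
  have hgap' := LoadBalancing.one_div_le_gap hc hG (hs.trans hsl)
  have hD' : (0 : ℝ) < (d + l : ℕ) := by exact_mod_cast (by omega : 0 < d + l)
  have hgap : 0 < LoadBalancing.gap G d l := lt_of_lt_of_le (by positivity) hgap'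
  have hgap1 := LoadBalancing.gap_le_one G d l
  have hℓ := LoadBalancing.two_thirds_le_log hn'
  obtain ⟨b, hb⟩ : ∃ b, b = 20 * δ *
    (Real.log (Fintype.card V) / LoadBalancing.gap G d l) := ⟨_, rfl⟩
  have hℓμ : 2 / 3 ≤ Real.log (Fintype.card V) / LoadBalancing.gap G d l := by
    rw [le_div_iff₀ hgap]; nlinarith
  have hb1 : 1 ≤ b := by rw [hb]; nlinarith
  obtain ⟨i, hi1, hi2⟩ := exists_nat_pow_near hb1 one_lt_two
  have hI2 : (2 : ℝ) ^ (i + 1) ≤ 2 * b := by rw [pow_succ]; linarith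
  have hlD : ((d + l : ℕ) : ℝ) ≤ (1 + κ') * d := by
    have : κ * d ≤ κ' * d := mul_le_mul_of_nonneg_right (le_max_left _ _) hd'.le
    push_cast
    linarith
  have htime := LoadBalancing.balancing_time_le hδ hκ0 hn' hd' (by exact_mod_cast hdn.le)
    (by exact_mod_cast (by omega : 1 ≤ d + l)) hlD hs' hgap hgap' hb hb1 hI2
  set X := (Real.log (LoadBalancing.discrepancy (A.load 0)) +
    Real.log (Fintype.card V)) / LoadBalancing.gap G d l with hX
  have hX0 : 2 / 3 ≤ X := by
    refine hℓμ.trans ?_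
    rw [hX, add_div]
    have : 0 ≤ Real.log (LoadBalancing.discrepancy (A.load 0)) / LoadBalancing.gap G d l :=
      div_nonneg (Real.log_natCast_nonneg _) hgap.le
    linarith
  have hT := Nat.ceil_lt_add_one (a := X) (by linarith)
  -- The starting time `⌈X⌉₊` is below `X + 1`, which is at most `3 * X` because `X ≥ 2 / 3`.
  have hCX : 3 * X ≤ 4000 * δ * (1 + κ') * (1 + Real.log (40 * δ * (1 + κ'))) * X := by
    refine mul_le_mul_of_nonneg_right ?_ (by linarith)
    have h1 : 1 ≤ δ * (1 + κ') := by nlinarith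
    have h2 : 1 ≤ δ * (1 + κ') * (1 + Real.log (40 * δ * (1 + κ'))) := by nlinarith
    linarith
  obtain ⟨u, v, huv⟩ := LoadBalancing.exists_load_sub_eq_discrepancy (A.load t)
  rw [huv]
  refine (LoadBalancing.Execution.load_sub_load_le hc hG hd hδ hgap hs hsl hA hn
    (Nat.le_ceil X) hb hb1 hi2.le hI2 ?_ u v).trans ?_
  · rw [mul_add] at ht
    linarith
  -- `3 ≤ 2 * δ + 1`, as `δ ≥ 1`.
  · nlinarith
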